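/- **Conventions.** Manifolds are real, smooth ($C^\infty$), Hausdorff, second countable. Let $Q$ be a topological space. An *orbifold chart* of dimension $n$ on $Q$ is a triple $(V,G,\pi)$ with $V$ a connected $n$-manifold, $G$ a finite subgroup of $\mathrm{Diff}(V)$, and $\pi\colon V\to Q$ a map with open image inducing a homeomorphism $G\backslash V\to\pi(V)$. Charts $(V,G,\pi)$, $(W,H,\chi)$ are *compatible* if for all $x\in V$, $y\in W$ with $\pi(x)=\chi(y)$ there is a diffeomorphism $h$ from a connected open neighbourhood of $x$ in $V$ onto one of $y$ in $W$ with $h(x)=y$ and $\chi\circ h=\pi$ (a *change of charts*). An *orbifold atlas* (of dimension $n$) is a set of pairwise compatible charts (of dimension $n$) whose images cover $Q$; an *orbifold structure* is a maximal orbifold atlas; a *representative* of an orbifold structure $\mathcal U$ is an orbifold atlas contained in $\mathcal U$. **Marked atlas groupoids.** For an atlas $\mathcal V=\{(V_i,G_i,\pi_i)\}_{i\in I}$ (distinct indices giving distinct charts) put $V=\coprod_i V_i$, $\pi=\coprod_i\pi_i$, and let $\Psi(\mathcal V)$ be the set of diffeomorphisms $f$ between open subsets of $V$ with $\pi\circ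 f=\pi|_{\mathrm{dom} f}$. The étale Lie groupoid $\Gamma(\mathcal V)$ has objects $V$ and arrows the germs $\mathrm{germ}_xf$ ($f\in\Psi(\mathcal V)$, $x\in\mathrm{dom} f$), with the germ topology and germ smooth structure, $s(\mathrm{germ}_xf)=x$, $t(\mathrm{germ}_xf)=f(x)$, and multiplication, units and inverses given by composition, identities and inverses of germs. It is marked by the homeomorphism $\alpha_{\mathcal V}\colon|\Gamma(\mathcal V)|\to Q$, $[x]\mapsto\pi(x)$, on its orbit space. $\mathrm{Hom}$ denotes smooth functors; a functor $\varphi=(\varphi_0,\varphi_1)$ induces a map $|\varphi|$ of orbit spaces. A homomorphism $\varphi\colon G\to H$ is a *weak equivalence* if $t\circ\mathrm{pr}_1\colon H_1\times_{s,\varphi_0}G_0\to H_0$ is a surjective submersion and the square formed by $\varphi_1$, $(s,t)$, $(s,t)$, $\varphi_0\times\varphi_0$ is a fibered product, i.e. $(s,t,\varphi_1)$ is a diffeomorphism of $G_1$ onto the submanifold $\{(x,y,h): s(h)=\varphi_0(x),\ t(h)=\varphi_0(y)\}$ of $G_0\times G_0\times H_1$. A homomorphism $\varphi\colon\Gamma(\mathcal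 V)\to\Gamma(\mathcal W')$ of atlas groupoids over the same $Q$ is a *unit weak equivalence* if it is a weak equivalence and $\alpha_{\mathcal W'}\circ|\varphi|\circ\alpha_{\mathcal V}^{-1}=\mathrm{id}_Q$. **Charted orbifold maps.** Let $\mathcal V$, $\mathcal W'$ be orbifold atlases on $Q$, $Q'$. Consider tuples $(f,\{\tilde f_i\}_{i\in I},P,\nu)$ where $f\colon Q\to Q'$ is continuous; each $\tilde f_i\colon V_i\to W'_{\tau(i)}$ is a smooth map into the domain of some chart $(W'_{\tau(i)},H'_{\tau(i)},\pi'_{\tau(i)})\in\mathcal W'$ with $\pi'_{\tau(i)}\circ\tilde f_i=f\circ\pi_i$; $P\subseteq\Psi(\mathcal V)$ consists of maps with connected domain, its germs are exactly the arrows of $\Gamma(\mathcal V)$, and they are closed under inverses and composition; and, with $\psi=\coprod_i\tilde f_i$, $\nu\colon P\to\Psi(\mathcal W')$ assigns to each $\lambda\in P$ a map whose domain $W$ is the domain of an orbifold chart $(W,H,\pi'|_W)$ on $Q'$, where $\pi'$ denotes the projection of $\mathcal W'$, such that $\psi(\mathrm{dom}\lambda)\subseteq\mathrm{dom}\,\nu(\lambda)$,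 $\psi\circ\lambda=\nu(\lambda)\circ\psi|_{\mathrm{dom}\lambda}$, and $\mathrm{germ}_x\lambda\mapsto\mathrm{germ}_{\psi(x)}\nu(\lambda)$ is well defined, multiplicative and preserves units. Two tuples are equivalent if they have the same $f$, the same $\tilde f_i$ and the same map $\mathrm{germ}_x\lambda\mapsto\mathrm{germ}_{\psi(x)}\nu(\lambda)$; the set of equivalence classes is $\mathrm{Orb}(\mathcal V,\mathcal W')$. The map $F_1\colon\mathrm{Orb}(\mathcal V,\mathcal W')\to\mathrm{Hom}(\Gamma(\mathcal V),\Gamma(\mathcal W'))$ sends the class of $(f,\{\tilde f_i\},P,\nu)$ to $(\psi,\ \mathrm{germ}_x\lambda\mapsto\mathrm{germ}_{\psi(x)}\nu(\lambda))$. Conversely, $F_2$ sends a homomorphism $\varphi$ to the class of any tuple with $f=\alpha_{\mathcal W'}\circ|\varphi|\circ\alpha_{\mathcal V}^{-1}$, $\tilde f_i=\varphi_0|_{V_i}$ and $\varphi_1(\mathrm{germ}_x\lambda)=\mathrm{germ}_{\varphi_0(x)}\nu(\lambda)$ for all $\lambda\in P$, $x\in\mathrm{dom}\lambda$. If $\mathcal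 V$ and $\mathcal W'$ are atlases on the same $Q$ and $\mathcal V$ is a representative of $\mathcal U$, an element of $\mathrm{Orb}(\mathcal V,\mathcal W')$ is a *lift of* $\mathrm{id}_{(Q,\mathcal U)}$ if $f=\mathrm{id}_Q$ and every $\tilde f_i$ is a local diffeomorphism. **Proposition.** Let $\mathcal U$ and $\mathcal U'$ be orbifold structures on the topological space $Q$, let $\mathcal V$ be a representative of $\mathcal U$ and $\mathcal W'$ a representative of $\mathcal U'$. (i) Suppose $\mathcal U=\mathcal U'$. If $\hat f\in\mathrm{Orb}(\mathcal V,\mathcal W')$ is a lift of $\mathrm{id}_{(Q,\mathcal U)}$, then $F_1(\hat f)$ is a unit weak equivalence. (ii) If $\varepsilon\in\mathrm{Hom}(\Gamma(\mathcal V),\Gamma(\mathcal W'))$ is a unit weak equivalence, then $\mathcal U=\mathcal U'$, and $F_2(\varepsilon)$ is a lift of $\mathrm{id}_{(Q,\mathcal U)}$. -/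

import Mathlib

open scoped Manifold ContDiff Topology

universe u v w

noncomputable section

namespace Orb

/-- An `n`-dimensional (reduced) orbifold chart `(V, G, π)` on `Q`: a connected smooth `n`-manifold `V`
(Hausdorff, second countable), a finite group `G` of diffeomorphisms of `V`, and a map `π : V → Q` with
open image that induces a homeomorphism from `G \ V` onto `π(V)`. Smoothness of all elements of the
group `G` makes each of them a diffeomorphism. -/
structure OrbifoldChart (n : ℕ) (Q : Type v) [TopologicalSpace Q] where
  V : Type u
  [topV : TopologicalSpace V]
  [chartedV : ChartedSpace (EuclideanSpace ℝ (Fin n)) V]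
  [manifoldV : IsManifold (𝓡 n) ∞ V]
  [t2V : T2Space V]
  [secondCountableV : SecondCountableTopology V]
  [connectedV : ConnectedSpace V]
  G : Subgroup (Equiv.Perm V)
  finite_G : Finite G
  smooth_G : ∀ g ∈ G, ContMDiff (𝓡 n) (𝓡 n) ∞ (g : V → V)
  π : V → Q
  isOpen_range : IsOpen (Set.range π)
  induces_homeo : ∃ h : Quotient (MulAction.orbitRel G V) ≃ₜ Set.range π,
    ∀ x : V, (h (Quotient.mk _ x) : Q) = π x

attribute [instance] OrbifoldChart.topV OrbifoldChart.chartedV OrbifoldChart.manifoldV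
  OrbifoldChart.t2V OrbifoldChart.secondCountableV OrbifoldChart.connectedV

variable {n : ℕ} {Q : Type v} [TopologicalSpace Q]

/-- A diffeomorphism between open subsets of `M` and `N`, given as an open partial homeomorphism
(only its values on `f.source` matter). -/
def IsTransition {n : ℕ} {M N : Type*} [TopologicalSpace M] [TopologicalSpace N]
    [ChartedSpace (EuclideanSpace ℝ (Fin n)) M] [ChartedSpace (EuclideanSpace ℝ (Fin n)) N]
    (f : OpenPartialHomeomorph M N) : Prop :=
  ContMDiffOn (𝓡 n) (𝓡 n) ∞ f f.source ∧ ContMDiffOn (𝓡 n) (𝓡 n) ∞ f.symm f.target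

/-- Compatibility of orbifold charts: whenever `c.π x = d.π y`, there is a diffeomorphism from a
connected open neighbourhood of `x` onto one of `y` which sends `x` to `y` and commutes with the
projections (a change of charts). -/
def Compatible (c d : OrbifoldChart.{u} n Q) : Prop :=
  ∀ (x : c.V) (y : d.V), c.π x = d.π y →
    ∃ h : OpenPartialHomeomorph c.V d.V, IsTransition (n := n) h ∧ IsConnected h.source ∧
      x ∈ h.source ∧ h x = y ∧ ∀ z ∈ h.source, d.π (h z) = c.π z

variable (n Q) in
/-- An orbifold atlas of dimension `n` on `Q`: pairwise compatible charts which cover `Q`. -/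
structure OrbifoldAtlas where
  charts : Set (OrbifoldChart.{u} n Q)
  compatible : ∀ c ∈ charts, ∀ d ∈ charts, Compatible c d
  covers : ⋃ c ∈ charts, Set.range c.π = Set.univ

variable (n Q) in
/-- An orbifold structure of dimension `n` on `Q`: a maximal orbifold atlas. -/
structure OrbifoldStructure extends OrbifoldAtlas.{u} n Q where
  maximal : ∀ A : OrbifoldAtlas.{u} n Q, charts ⊆ A.charts → A.charts ⊆ charts

/-- The orbifold structure as a set of charts of arbitrary dimension, so that structures whose
dimensions are not known to agree in advance can be compared. -/
def OrbifoldStructure.chartSet (U : OrbifoldStructure.{u} n Q) :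
    Set (Σ n : ℕ, OrbifoldChart.{u} n Q) :=
  Sigma.mk n '' U.charts

/-- `A` is a representative of `U`: an orbifold atlas contained in the maximal atlas `U`. -/
def OrbifoldAtlas.Represents (A : OrbifoldAtlas.{u} n Q) (U : OrbifoldStructure.{u} n Q) : Prop :=
  A.charts ⊆ U.charts

/-- The manifold `∐ V_i`, the disjoint union of the domains of all charts of the atlas. -/
def OrbifoldAtlas.Total (A : OrbifoldAtlas.{u} n Q) : Type _ := Σ c : A.charts, c.1.V

namespace OrbifoldAtlas

variable (A : OrbifoldAtlas.{u} n Q)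

instance : TopologicalSpace A.Total :=
  inferInstanceAs (TopologicalSpace (Σ c : A.charts, c.1.V))

/-- The inclusion of the component `V_c`. -/
def incl (c : A.charts) (x : c.1.V) : A.Total := ⟨c, x⟩

lemma isOpenEmbedding_incl (c : A.charts) : Topology.IsOpenEmbedding (A.incl c) :=
  Topology.IsOpenEmbedding.sigmaMk (σ := fun c : A.charts => c.1.V) (i := c)

instance : ChartedSpace (EuclideanSpace ℝ (Fin n)) A.Total where
  atlas := {e | ∃ (c : A.charts), ∃ e' ∈ atlas (EuclideanSpace ℝ (Fin n)) c.1.V,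
    e = e'.lift_openEmbedding (A.isOpenEmbedding_incl c)}
  chartAt p := (chartAt (EuclideanSpace ℝ (Fin n)) p.2).lift_openEmbedding
    (A.isOpenEmbedding_incl p.1)
  mem_chart_source p := ⟨p.2, mem_chart_source _ p.2, rfl⟩
  chart_mem_atlas p := ⟨p.1, _, chart_mem_atlas _ p.2, rfl⟩

instance : IsManifold (𝓡 n) ∞ A.Total where
  compatible := by
    rintro _ _ ⟨c, e, he, rfl⟩ ⟨d, e', he', rfl⟩
    by_cases hcd : c = d
    · subst hcd
      rw [e.lift_openEmbedding_trans e']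
      exact c.1.manifoldV.compatible he he'
    · refine ContDiffGroupoid.mem_of_source_eq_empty _ ?_
      ext x
      refine ⟨?_, fun hx => hx.elim⟩
      rintro ⟨-, y, -, hy⟩
      exact hcd (congrArg Sigma.fst hy).symm

/-- The map `∐ π_i : ∐ V_i → Q`. -/
def proj (p : A.Total) : Q := p.1.1.π p.2

/-- The pseudogroup `Ψ(A)` of all transitions `f` on `∐ V_i` with `π ∘ f = π` on `dom f`. -/
def Psi : Set (OpenPartialHomeomorph A.Total A.Total) :=
  {f | IsTransition (n := n) f ∧ ∀ x ∈ f.source, A.proj (f x) = A.proj x}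


variable {A}

lemma IsTransition.restr' {n : ℕ} {M N : Type*} [TopologicalSpace M] [TopologicalSpace N]
    [ChartedSpace (EuclideanSpace ℝ (Fin n)) M] [ChartedSpace (EuclideanSpace ℝ (Fin n)) N]
    {f : OpenPartialHomeomorph M N} (hf : IsTransition (n := n) f) {s : Set M} (hs : IsOpen s) :
    IsTransition (n := n) (f.restrOpen s hs) :=
  ⟨hf.1.mono fun _ hx => hx.1, hf.2.mono fun _ hx => hx.1⟩

lemma refl_mem_Psi : OpenPartialHomeomorph.refl A.Total ∈ A.Psi :=
  ⟨⟨contMDiff_id.contMDiffOn, contMDiff_id.contMDiffOn⟩, fun _ _ => rfl⟩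

lemma symm_mem_Psi {f : OpenPartialHomeomorph A.Total A.Total} (hf : f ∈ A.Psi) :
    f.symm ∈ A.Psi := by
  refine ⟨⟨hf.1.2, by simpa using hf.1.1⟩, fun x hx => ?_⟩
  have := hf.2 (f.symm x) (f.map_target hx)
  rw [f.right_inv hx] at this
  exact this.symm

lemma trans_mem_Psi {f g : OpenPartialHomeomorph A.Total A.Total} (hf : f ∈ A.Psi)
    (hg : g ∈ A.Psi) : f.trans g ∈ A.Psi := by
  refine ⟨⟨?_, ?_⟩, fun x hx => ?_⟩
  · exact hg.1.1.comp (hf.1.1.mono fun x hx => (by simpa using hx : _ ∧ _).1)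
      fun x hx => (by simpa using hx : _ ∧ _).2
  · have h := hf.1.2.comp (hg.1.2.mono (t := (f.trans g).target) fun x hx => ?_) fun x hx => ?_
    · exact h
    · rw [OpenPartialHomeomorph.trans_target] at hx; exact hx.1
    · rw [OpenPartialHomeomorph.trans_target] at hx; exact hx.2
  · have h : x ∈ f.source ∧ f x ∈ g.source := by simpa using hx
    exact (hg.2 _ h.2).trans (hf.2 _ h.1)

lemma restr_mem_Psi {f : OpenPartialHomeomorph A.Total A.Total} (hf : f ∈ A.Psi)
    {s : Set A.Total} (hs : IsOpen s) : f.restrOpen s hs ∈ A.Psi :=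
  ⟨IsTransition.restr' hf.1 hs, fun x hx => hf.2 x hx.1⟩

variable (A)

/-- Two pairs `(f, x)`, `(g, y)` are identified when `x = y` and `f`, `g` agree near `x`. -/
def germSetoid : Setoid {p : A.Psi × A.Total // p.2 ∈ p.1.1.source} where
  r p q := p.1.2 = q.1.2 ∧ (p.1.1.1 : A.Total → A.Total) =ᶠ[𝓝 p.1.2] q.1.1.1
  iseqv :=
    { refl := fun _ => ⟨rfl, Filter.EventuallyEq.rfl⟩
      symm := fun h => ⟨h.1.symm, h.1 ▸ h.2.symm⟩
      trans := fun h k => ⟨h.1.trans k.1, h.2.trans (h.1 ▸ k.2)⟩ }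

/-- The arrows of the atlas groupoid `Γ(A)`: germs of elements of `Ψ(A)`. Its objects are the points of
`A.Total`. -/
def Arrow : Type _ := Quotient A.germSetoid

variable {A}

/-- `germ_x f` for `f ∈ Ψ(A)` and `x ∈ dom f`. -/
def germ {f : OpenPartialHomeomorph A.Total A.Total} (hf : f ∈ A.Psi) (x : A.Total)
    (hx : x ∈ f.source) : A.Arrow :=
  Quotient.mk A.germSetoid ⟨(⟨f, hf⟩, x), hx⟩

lemma germ_eq_germ {f g : OpenPartialHomeomorph A.Total A.Total} {hf : f ∈ A.Psi} {hg : g ∈ A.Psi}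
    {x y : A.Total} {hx : x ∈ f.source} {hy : y ∈ g.source} :
    germ hf x hx = germ hg y hy ↔ x = y ∧ (f : A.Total → A.Total) =ᶠ[𝓝 x] g :=
  Quotient.eq (r := A.germSetoid)

namespace Arrow

/-- Source: `s(germ_x f) = x`. -/
def src (a : A.Arrow) : A.Total := Quotient.lift (s := A.germSetoid) (fun p => p.1.2) (fun _ _ h => h.1) a

/-- Target: `t(germ_x f) = f x`. -/
def tgt (a : A.Arrow) : A.Total :=
  Quotient.lift (s := A.germSetoid) (fun p => p.1.1.1 p.1.2) (fun _ _ h => h.2.eq_of_nhds.trans (by rw [h.1])) a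

/-- Unit: the germ of the identity. -/
def unit (x : A.Total) : A.Arrow := germ refl_mem_Psi x (Set.mem_univ x)

/-- Inversion: `germ_x f ↦ germ_{f x} f⁻¹`. -/
def inv (a : A.Arrow) : A.Arrow :=
  Quotient.lift (fun p : {p : A.Psi × A.Total // p.2 ∈ p.1.1.source} =>
      germ (symm_mem_Psi p.1.1.2) (p.1.1.1 p.1.2) (p.1.1.1.map_source p.2))
    (by
      rintro ⟨⟨⟨f, hf⟩, x⟩, hx⟩ ⟨⟨⟨g, hg⟩, y⟩, hy⟩ ⟨h1, h2⟩
      dsimp only at h1 h2 hx hy ⊢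
      subst h1
      refine germ_eq_germ.2 ⟨h2.eq_of_nhds, ?_⟩
      have hc : Filter.Tendsto f.symm (𝓝 (f x)) (𝓝 x) := by
        have := f.symm.continuousAt (f.map_source hx)
        rwa [ContinuousAt, f.left_inv hx] at this
      filter_upwards [hc.eventually h2, f.open_target.mem_nhds (f.map_source hx),
        hc.eventually (g.open_source.mem_nhds hy)] with z hz1 hz2 hz3
      rw [f.right_inv hz2] at hz1
      rw [hz1, g.left_inv hz3, ← hz1]) a

lemma exists_eq_germ (a : A.Arrow) : ∃ (f : OpenPartialHomeomorph A.Total A.Total)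
    (hf : f ∈ A.Psi) (x : A.Total) (hx : x ∈ f.source), a = germ hf x hx := by
  induction a using Quotient.inductionOn with
  | h p => exact ⟨p.1.1.1, p.1.1.2, p.1.2, p.2, rfl⟩

/-- A transition whose germ at `a.src` is `a`. -/
def rep (a : A.Arrow) : OpenPartialHomeomorph A.Total A.Total := a.exists_eq_germ.choose

lemma rep_mem (a : A.Arrow) : a.rep ∈ A.Psi := a.exists_eq_germ.choose_spec.choose

lemma rep_spec (a : A.Arrow) : ∃ hx : a.src ∈ a.rep.source, a = germ a.rep_mem a.src hx := by
  obtain ⟨x, hx, h⟩ := a.exists_eq_germ.choose_spec.choose_spec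
  have hs : a.src = x := congrArg src h
  exact ⟨hs ▸ hx, h.trans (germ_eq_germ.2 ⟨hs.symm, Filter.EventuallyEq.rfl⟩)⟩

lemma src_mem (a : A.Arrow) : a.src ∈ a.rep.source := a.rep_spec.1

lemma germ_rep (a : A.Arrow) : germ a.rep_mem a.src a.src_mem = a := a.rep_spec.2.symm

lemma rep_src (a : A.Arrow) : a.rep a.src = a.tgt := congrArg tgt a.germ_rep

/-- Multiplication: `m(germ_{f x} g, germ_x f) = germ_x (g ∘ f)`, see `mul_germ`. -/
def mul (b a : A.Arrow) (h : b.src = a.tgt) : A.Arrow :=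
  germ (trans_mem_Psi a.rep_mem b.rep_mem) a.src
    (by
      rw [OpenPartialHomeomorph.trans_source]
      exact ⟨a.src_mem, by
        rw [Set.mem_preimage, a.rep_src, ← h]; exact b.src_mem⟩)

lemma rep_germ {f : OpenPartialHomeomorph A.Total A.Total} (hf : f ∈ A.Psi) (x : A.Total)
    (hx : x ∈ f.source) : ((germ hf x hx).rep : A.Total → A.Total) =ᶠ[𝓝 x] f :=
  (germ_eq_germ.1 (germ_rep (germ hf x hx))).2

lemma mul_germ {f g : OpenPartialHomeomorph A.Total A.Total} (hf : f ∈ A.Psi) (hg : g ∈ A.Psi)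
    (x : A.Total) (hx : x ∈ f.source) (hfx : f x ∈ g.source) (h) :
    mul (germ hg (f x) hfx) (germ hf x hx) h =
      germ (trans_mem_Psi hf hg) x
        (by rw [OpenPartialHomeomorph.trans_source]; exact ⟨hx, hfx⟩) := by
  refine germ_eq_germ.2 ⟨rfl, ?_⟩
  have h1 := rep_germ hf x hx
  have h2 := rep_germ hg (f x) hfx
  change (_ : A.Total → A.Total) =ᶠ[𝓝 x] _
  filter_upwards [h1, (f.continuousAt hx).eventually h2] with z hz1 hz2
  simp only [OpenPartialHomeomorph.coe_trans, Function.comp_apply, hz1, hz2]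

/-- The germ topology, generated by the sets `{germ_x f | x ∈ dom f}`. -/
instance : TopologicalSpace A.Arrow :=
  TopologicalSpace.generateFrom
    {s | ∃ (f : OpenPartialHomeomorph A.Total A.Total) (hf : f ∈ A.Psi),
      s = {a | ∃ (x : A.Total) (hx : x ∈ f.source), a = germ hf x hx}}

/-- The basic open set `{germ_x f | x ∈ dom f}`. -/
def basic {f : OpenPartialHomeomorph A.Total A.Total} (hf : f ∈ A.Psi) : Set A.Arrow :=
  {a | ∃ (x : A.Total) (hx : x ∈ f.source), a = germ hf x hx}

lemma isOpen_basic {f : OpenPartialHomeomorph A.Total A.Total} (hf : f ∈ A.Psi) :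
    IsOpen (basic hf) :=
  TopologicalSpace.isOpen_generateFrom_of_mem ⟨f, hf, rfl⟩

open Classical in
/-- The chart `{germ_x f | x ∈ dom f} → dom f`, `germ_x f ↦ x`, of the germ differential structure
(with values in the manifold `∐ V_i`). -/
def chart {f : OpenPartialHomeomorph A.Total A.Total} (hf : f ∈ A.Psi) :
    OpenPartialHomeomorph A.Arrow A.Total where
  toFun := src
  invFun x := if hx : x ∈ f.source then germ hf x hx else unit x
  source := basic hf
  target := f.source
  map_source' := by rintro _ ⟨x, hx, rfl⟩; exact hx
  map_target' x hx := ⟨x, hx, dif_pos hx⟩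
  left_inv' := by rintro _ ⟨x, hx, rfl⟩; exact dif_pos hx
  right_inv' x hx := by rw [dif_pos hx]; rfl
  open_source := isOpen_basic hf
  open_target := f.open_source
  continuousOn_toFun := by
    rw [continuousOn_open_iff (isOpen_basic hf)]
    intro t ht
    convert isOpen_basic (restr_mem_Psi hf ht) using 1
    ext a
    constructor
    · rintro ⟨⟨x, hx, rfl⟩, h2⟩
      exact ⟨x, ⟨hx, h2⟩, germ_eq_germ.2 ⟨rfl, Filter.EventuallyEq.rfl⟩⟩
    · rintro ⟨x, hx, rfl⟩
      exact ⟨⟨x, hx.1, germ_eq_germ.2 ⟨rfl, Filter.EventuallyEq.rfl⟩⟩, hx.2⟩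
  continuousOn_invFun := by
    rw [continuousOn_iff_continuous_domRestrict]
    refine continuous_generateFrom_iff.2 ?_
    rintro _ ⟨g, hg, rfl⟩
    rw [isOpen_iff_mem_nhds]
    rintro ⟨x, hx⟩ ⟨y, hy, hxy⟩
    rw [Set.domRestrict_apply, dif_pos hx, germ_eq_germ] at hxy
    obtain ⟨rfl, h⟩ := hxy
    rw [mem_nhds_subtype_iff_nhdsWithin]
    refine mem_nhdsWithin_of_mem_nhds ?_
    filter_upwards [h.eventually_nhds, f.open_source.mem_nhds hx, g.open_source.mem_nhds hy]
      with z hz1 hz2 hz3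
    refine ⟨⟨z, hz2⟩, ⟨z, hz3, ?_⟩, rfl⟩
    rw [Set.domRestrict_apply, dif_pos hz2, germ_eq_germ]
    exact ⟨rfl, hz1⟩

lemma src_chart_symm {f : OpenPartialHomeomorph A.Total A.Total} (hf : f ∈ A.Psi) (z : A.Total) :
    ((chart hf).symm z).src = z := by
  by_cases hz : z ∈ f.source
  · exact congrArg src (dif_pos hz : (chart hf).symm z = germ hf z hz)
  · exact congrArg src (dif_neg hz : (chart hf).symm z = unit z)

@[reducible] def chartedSpaceTotal : ChartedSpace A.Total A.Arrow where
  atlas := {e | ∃ (f : OpenPartialHomeomorph A.Total A.Total) (hf : f ∈ A.Psi), e = chart hf}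
  chartAt a := chart a.rep_mem
  mem_chart_source a := ⟨a.src, a.src_mem, a.germ_rep.symm⟩
  chart_mem_atlas a := ⟨a.rep, a.rep_mem, rfl⟩

instance : ChartedSpace (EuclideanSpace ℝ (Fin n)) A.Arrow :=
  letI := chartedSpaceTotal (A := A)
  ChartedSpace.comp (EuclideanSpace ℝ (Fin n)) A.Total A.Arrow

lemma compatible_trans_trans {n : ℕ} {X M : Type*} [TopologicalSpace X] [TopologicalSpace M]
    [ChartedSpace (EuclideanSpace ℝ (Fin n)) M] [IsManifold (𝓡 n) ∞ M]
    {e e' : OpenPartialHomeomorph X M} (hee' : (e : X → M) = e')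
    {c c' : OpenPartialHomeomorph M (EuclideanSpace ℝ (Fin n))}
    (hc : c ∈ atlas (EuclideanSpace ℝ (Fin n)) M) (hc' : c' ∈ atlas (EuclideanSpace ℝ (Fin n)) M) :
    (e.trans c).symm.trans (e'.trans c') ∈ contDiffGroupoid ∞ (𝓡 n) := by
  have key : ∀ y ∈ ((e.trans c).symm.trans (e'.trans c')).source,
      y ∈ (c.symm.trans c').source ∧
        ((e.trans c).symm.trans (e'.trans c')) y = (c.symm.trans c') y := by
    intro y hy
    rw [OpenPartialHomeomorph.trans_source, OpenPartialHomeomorph.symm_source,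
      OpenPartialHomeomorph.trans_target, OpenPartialHomeomorph.trans_source] at hy
    obtain ⟨⟨h1, h2⟩, h3, h4⟩ := hy
    have h5 : e' (e.symm (c.symm y)) = c.symm y := by
      rw [← hee']
      exact e.right_inv h2
    have h4' : e' (e.symm (c.symm y)) ∈ c'.source := h4
    rw [h5] at h4'
    refine ⟨?_, congrArg c' h5⟩
    rw [OpenPartialHomeomorph.trans_source]
    exact ⟨h1, h4'⟩
  refine (contDiffGroupoid ∞ (𝓡 n)).mem_of_eqOnSource
    (closedUnderRestriction' (HasGroupoid.compatible hc hc')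
      ((e.trans c).symm.trans (e'.trans c')).open_source) ⟨?_, fun y hy => (key y hy).2⟩
  rw [OpenPartialHomeomorph.restr_source, IsOpen.interior_eq (OpenPartialHomeomorph.open_source _)]
  exact (Set.inter_eq_right.2 fun y hy => (key y hy).1).symm

instance : IsManifold (𝓡 n) ∞ A.Arrow where
  compatible := by
    rintro _ _ ⟨_, ⟨f, hf, rfl⟩, c, hc, rfl⟩ ⟨_, ⟨g, hg, rfl⟩, c', hc', rfl⟩
    have h : (chart hf : A.Arrow → A.Total) = chart hg := rfl
    exact compatible_trans_trans h hc hc'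

end Arrow

variable (A)

/-- Two objects are equivalent if there is an arrow between them. -/
def orbitSetoid : Setoid A.Total where
  r x y := ∃ a : A.Arrow, a.src = x ∧ a.tgt = y
  iseqv :=
    { refl := fun x => ⟨Arrow.unit x, rfl, rfl⟩
      symm := by
        rintro _ _ ⟨a, rfl, rfl⟩
        obtain ⟨f, hf, x, hx, rfl⟩ := a.exists_eq_germ
        exact ⟨Arrow.inv (germ hf x hx), rfl, f.left_inv hx⟩
      trans := by
        rintro _ _ _ ⟨a, rfl, rfl⟩ ⟨b, h, rfl⟩
        refine ⟨Arrow.mul b a h, rfl, ?_⟩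
        change b.rep (a.rep a.src) = b.tgt
        rw [a.rep_src, ← h, b.rep_src] }

/-- The orbit space `|Γ(A)|`. -/
def OrbitSpace : Type _ := Quotient A.orbitSetoid

instance : TopologicalSpace A.OrbitSpace :=
  inferInstanceAs (TopologicalSpace (Quotient A.orbitSetoid))

end OrbifoldAtlas

lemma OrbifoldChart.continuous_π (c : OrbifoldChart.{u} n Q) : Continuous c.π := by
  obtain ⟨h, hh⟩ := c.induces_homeo
  have : c.π = fun x => (h (Quotient.mk _ x) : Q) := funext fun x => (hh x).symm
  rw [this]
  exact continuous_subtype_val.comp (h.continuous.comp continuous_quotient_mk')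

lemma OrbifoldChart.isOpenMap_π (c : OrbifoldChart.{u} n Q) : IsOpenMap c.π := by
  obtain ⟨h, hh⟩ := c.induces_homeo
  have : c.π = Subtype.val ∘ h ∘ Quotient.mk _ := funext fun x => (hh x).symm
  have hc : ContinuousConstSMul c.G c.V := ⟨fun g => (c.smooth_G g.1 g.2).continuous⟩
  rw [this]
  exact c.isOpen_range.isOpenMap_subtype_val.comp
    (h.isOpenMap.comp isOpenMap_quotient_mk'_mul)

namespace OrbifoldAtlas

variable (A : OrbifoldAtlas.{u} n Q)

lemma continuous_proj : Continuous A.proj :=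
  continuous_sigma fun c => c.1.continuous_π

lemma isOpenMap_proj : IsOpenMap A.proj :=
  isOpenMap_sigma.2 fun c => c.1.isOpenMap_π

lemma surjective_proj : Function.Surjective A.proj := by
  intro q
  have hq : q ∈ ⋃ c ∈ A.charts, Set.range c.π := A.covers ▸ Set.mem_univ q
  simp only [Set.mem_iUnion, Set.mem_range] at hq
  obtain ⟨c, hc, x, hx⟩ := hq
  exact ⟨⟨⟨c, hc⟩, x⟩, hx⟩

lemma contMDiff_incl (c : A.charts) : ContMDiff (𝓡 n) (𝓡 n) ∞ (A.incl c) := by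
  intro x
  have h := contMDiffAt_id (I := 𝓡 n) (n := ∞) (x := x)
  rw [contMDiffAt_iff] at h ⊢
  refine ⟨(A.isOpenEmbedding_incl c).continuous.continuousAt, h.2.congr_of_mem ?_ ?_⟩
  · intro y _
    exact OpenPartialHomeomorph.lift_openEmbedding_apply _ (A.isOpenEmbedding_incl c)
  · simp

/-- The inclusion of a component, as an open partial homeomorphism. -/
def inclHomeo (c : A.charts) : OpenPartialHomeomorph c.1.V A.Total :=
  (A.isOpenEmbedding_incl c).toOpenPartialHomeomorph (A.incl c)

lemma contMDiffOn_inclHomeo_symm (c : A.charts) :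
    ContMDiffOn (𝓡 n) (𝓡 n) ∞ (A.inclHomeo c).symm (A.inclHomeo c).target := by
  intro p hp
  obtain ⟨x, rfl⟩ : ∃ x, A.incl c x = p := by
    simpa [inclHomeo] using hp
  refine ContMDiffAt.contMDiffWithinAt ?_
  have hx : (A.inclHomeo c).symm (A.incl c x) = x :=
    (A.inclHomeo c).left_inv (by simp [inclHomeo])
  have h := contMDiffAt_id (I := 𝓡 n) (n := ∞) (x := x)
  rw [contMDiffAt_iff] at h ⊢
  refine ⟨(A.inclHomeo c).symm.continuousAt hp, ?_⟩
  rw [hx]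
  have hz : extChartAt (𝓡 n) (A.incl c x) (A.incl c x) = extChartAt (𝓡 n) x x :=
    OpenPartialHomeomorph.lift_openEmbedding_apply _ (A.isOpenEmbedding_incl c)
  rw [hz]
  refine h.2.congr_of_mem ?_ (by simp)
  intro y _
  have hy : (A.inclHomeo c).symm (A.incl c ((extChartAt (𝓡 n) x).symm y)) =
      (extChartAt (𝓡 n) x).symm y := (A.inclHomeo c).left_inv (by simp [inclHomeo])
  exact congrArg (extChartAt (𝓡 n) x) hy

lemma exists_mem_Psi {x y : A.Total} (h : A.proj x = A.proj y) :
    ∃ f ∈ A.Psi, x ∈ f.source ∧ f x = y := by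
  obtain ⟨c, x⟩ := x
  obtain ⟨d, y⟩ := y
  obtain ⟨k, hk, -, hx, hxy, hp⟩ := A.compatible c.1 c.2 d.1 d.2 x y h
  have hl : ∀ (c : A.charts) (z : c.1.V), (A.inclHomeo c).symm (A.incl c z) = z := fun c z =>
    (A.inclHomeo c).left_inv (by simp [inclHomeo])
  have hsrc : ∀ p, p ∈ ((A.inclHomeo c).symm.trans (k.trans (A.inclHomeo d))).source →
      ∃ z ∈ k.source, A.incl c z = p := by
    intro p hp
    rw [OpenPartialHomeomorph.trans_source] at hp
    obtain ⟨z, rfl⟩ : ∃ z, A.incl c z = p := by simpa [inclHomeo] using hp.1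
    have h2 := hp.2
    rw [Set.mem_preimage, hl, OpenPartialHomeomorph.trans_source] at h2
    exact ⟨z, h2.1, rfl⟩
  refine ⟨(A.inclHomeo c).symm.trans (k.trans (A.inclHomeo d)), ⟨⟨?_, ?_⟩, ?_⟩, ?_, ?_⟩
  · refine (A.contMDiff_incl d).comp_contMDiffOn (hk.1.comp
      ((A.contMDiffOn_inclHomeo_symm c).mono fun p hp => hp.1) ?_)
    intro p hp
    obtain ⟨z, hz, rfl⟩ := hsrc p hp
    change (A.inclHomeo c).symm (A.incl c z) ∈ k.source
    rw [hl]
    exact hz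
  · refine (A.contMDiff_incl c).comp_contMDiffOn (hk.2.comp
      ((A.contMDiffOn_inclHomeo_symm d).mono ?_) ?_)
    · intro p hp
      rw [OpenPartialHomeomorph.trans_target, OpenPartialHomeomorph.trans_target] at hp
      exact hp.1.1
    · intro p hp
      rw [OpenPartialHomeomorph.trans_target, OpenPartialHomeomorph.trans_target] at hp
      exact hp.1.2
  · intro p hp'
    obtain ⟨z, hz, rfl⟩ := hsrc p hp'
    change A.proj (A.incl d (k ((A.inclHomeo c).symm (A.incl c z)))) = _
    rw [hl]
    exact hp z hz
  · rw [OpenPartialHomeomorph.trans_source]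
    refine ⟨⟨x, trivial, rfl⟩, ?_⟩
    change (A.inclHomeo c).symm (A.incl c x) ∈ (k.trans (A.inclHomeo d)).source
    rw [hl, OpenPartialHomeomorph.trans_source]
    exact ⟨hx, trivial⟩
  · change A.incl d (k ((A.inclHomeo c).symm (A.incl c x))) = _
    rw [hl, hxy]
    rfl

/-- The map `[x] ↦ π x` from the orbit space to `Q`. -/
def markingFun (o : A.OrbitSpace) : Q :=
  Quotient.lift (s := A.orbitSetoid) A.proj
    (by
      rintro _ _ ⟨a, rfl, rfl⟩
      obtain ⟨f, hf, x, hx, rfl⟩ := a.exists_eq_germ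
      exact (hf.2 x hx).symm) o

lemma markingFun_bijective : Function.Bijective A.markingFun := by
  refine ⟨?_, fun q => ?_⟩
  · intro o o'
    induction o using Quotient.inductionOn with | h x => ?_
    induction o' using Quotient.inductionOn with | h y => ?_
    intro h
    obtain ⟨f, hf, hx, hy⟩ := A.exists_mem_Psi (x := x) (y := y) h
    exact Quotient.sound (s := A.orbitSetoid) ⟨germ hf x hx, rfl, hy⟩
  · obtain ⟨x, rfl⟩ := A.surjective_proj q
    exact ⟨Quotient.mk A.orbitSetoid x, rfl⟩

lemma continuous_markingFun : Continuous A.markingFun :=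
  A.continuous_proj.quotient_lift _

lemma isOpenMap_markingFun : IsOpenMap A.markingFun := by
  intro s hs
  have : A.markingFun '' s = A.proj '' (Quotient.mk A.orbitSetoid ⁻¹' s) := by
    ext q
    constructor
    · rintro ⟨o, ho, rfl⟩
      induction o using Quotient.inductionOn with | h x => ?_
      exact ⟨x, ho, rfl⟩
    · rintro ⟨x, hx, rfl⟩
      exact ⟨_, hx, rfl⟩
  rw [this]
  exact A.isOpenMap_proj _ (hs.preimage continuous_quotient_mk')

/-- The marking `α_A : |Γ(A)| ≃ₜ Q`, `[x] ↦ π x`, of the atlas groupoid. -/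
def marking : A.OrbitSpace ≃ₜ Q :=
  (Equiv.ofBijective A.markingFun A.markingFun_bijective).toHomeomorphOfContinuousOpen
    A.continuous_markingFun A.isOpenMap_markingFun
end OrbifoldAtlas

variable {n' : ℕ} {Q' : Type w} [TopologicalSpace Q']

/-- A homomorphism `Γ(A) → Γ(B)` of Lie groupoids: smooth maps on objects and on arrows which commute
with all structure maps. -/
structure Hom (A : OrbifoldAtlas.{u} n Q) (B : OrbifoldAtlas.{u} n' Q') where
  obj : A.Total → B.Total
  arr : A.Arrow → B.Arrow
  smooth_obj : ContMDiff (𝓡 n) (𝓡 n') ∞ obj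
  smooth_arr : ContMDiff (𝓡 n) (𝓡 n') ∞ arr
  map_src : ∀ a, (arr a).src = obj a.src
  map_tgt : ∀ a, (arr a).tgt = obj a.tgt
  map_mul : ∀ (b a : A.Arrow) (h : b.src = a.tgt),
    arr (b.mul a h) = (arr b).mul (arr a) ((map_src b).trans ((congrArg obj h).trans (map_tgt a).symm))
  map_unit : ∀ x, arr (.unit x) = .unit (obj x)
  map_inv : ∀ a, arr a.inv = (arr a).inv

namespace Hom

variable {A : OrbifoldAtlas.{u} n Q} {B : OrbifoldAtlas.{u} n' Q'} (φ : Hom A B)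

/-- The induced map `|φ| : |Γ(A)| → |Γ(B)|`. -/
def orbitMap (o : A.OrbitSpace) : B.OrbitSpace :=
  Quotient.lift (s := A.orbitSetoid) (fun x => (Quotient.mk B.orbitSetoid (φ.obj x) : B.OrbitSpace))
    (by
      rintro _ _ ⟨a, rfl, rfl⟩
      exact Quotient.sound (s := B.orbitSetoid) ⟨φ.arr a, φ.map_src a, φ.map_tgt a⟩) o

/-- The fibered product `H₁ ×_{s, φ₀} G₀` for `φ : G → H`, with the subspace topology. As `s` is a local
diffeomorphism, the submanifold structure is the one for which the projection to `G₀` is a local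
diffeomorphism; these local inverses of the projection are the charts below. -/
def EssFiber : Type _ := {p : B.Arrow × A.Total // p.1.src = φ.obj p.2}

namespace EssFiber

instance : TopologicalSpace φ.EssFiber :=
  inferInstanceAs (TopologicalSpace {p : B.Arrow × A.Total // p.1.src = φ.obj p.2})

variable {φ}

lemma continuous_arrow : Continuous fun p : φ.EssFiber => p.1.1 :=
  continuous_fst.comp continuous_subtype_val

lemma continuous_base : Continuous fun p : φ.EssFiber => p.1.2 :=
  continuous_snd.comp continuous_subtype_val

def chart {f : OpenPartialHomeomorph B.Total B.Total} (hf : f ∈ B.Psi) :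
    OpenPartialHomeomorph φ.EssFiber A.Total where
  toFun p := p.1.2
  invFun y := ⟨((OrbifoldAtlas.Arrow.chart hf).symm (φ.obj y), y), OrbifoldAtlas.Arrow.src_chart_symm hf _⟩
  source := {p | p.1.1 ∈ OrbifoldAtlas.Arrow.basic hf}
  target := φ.obj ⁻¹' f.source
  map_source' := by
    rintro ⟨⟨h, y⟩, hy⟩ ⟨x, hx, rfl⟩
    change φ.obj y ∈ f.source
    rw [← hy]
    exact hx
  map_target' y hy := (OrbifoldAtlas.Arrow.chart hf).map_target hy
  left_inv' := by
    rintro ⟨⟨h, y⟩, hy⟩ hp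
    refine Subtype.ext (Prod.ext ?_ rfl)
    change (OrbifoldAtlas.Arrow.chart hf).symm (φ.obj y) = h
    rw [← hy]
    exact (OrbifoldAtlas.Arrow.chart hf).left_inv hp
  right_inv' _ _ := rfl
  open_source := (OrbifoldAtlas.Arrow.isOpen_basic hf).preimage continuous_arrow
  open_target := f.open_source.preimage φ.smooth_obj.continuous
  continuousOn_toFun := continuous_base.continuousOn
  continuousOn_invFun := by
    refine Topology.IsInducing.subtypeVal.continuousOn_iff.2 ?_
    refine ContinuousOn.prodMk ?_ continuousOn_id
    exact (OrbifoldAtlas.Arrow.chart hf).continuousOn_symm.comp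
      φ.smooth_obj.continuous.continuousOn fun _ hy => hy

@[reducible] def chartedSpaceTotal : ChartedSpace A.Total φ.EssFiber where
  atlas := {e | ∃ (f : OpenPartialHomeomorph B.Total B.Total) (hf : f ∈ B.Psi), e = chart hf}
  chartAt p := chart p.1.1.rep_mem
  mem_chart_source p := ⟨p.1.1.src, p.1.1.src_mem, p.1.1.germ_rep.symm⟩
  chart_mem_atlas p := ⟨p.1.1.rep, p.1.1.rep_mem, rfl⟩

instance : ChartedSpace (EuclideanSpace ℝ (Fin n)) φ.EssFiber :=
  letI := chartedSpaceTotal (φ := φ)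
  ChartedSpace.comp (EuclideanSpace ℝ (Fin n)) A.Total φ.EssFiber

instance : IsManifold (𝓡 n) ∞ φ.EssFiber where
  compatible := by
    rintro _ _ ⟨_, ⟨f, hf, rfl⟩, c, hc, rfl⟩ ⟨_, ⟨g, hg, rfl⟩, c', hc', rfl⟩
    have h : (chart hf : φ.EssFiber → A.Total) = chart hg := rfl
    exact OrbifoldAtlas.Arrow.compatible_trans_trans h hc hc'

/-- The map `t ∘ pr₁`. -/
def tgt (p : φ.EssFiber) : B.Total := p.1.1.tgt

end EssFiber

/-- Weak equivalences: `t ∘ pr₁ : H₁ ×_{s, φ₀} G₀ → H₀` is a surjective submersion, and the square with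
sides `φ₁`, `(s, t)`, `(s, t)`, `φ₀ × φ₀` is a fibered product of manifolds, that is, the map
`(s, t, φ₁)` is a diffeomorphism of `G₁` onto the submanifold
`{(x, y, h) | (φ₀ x, φ₀ y) = (s h, t h)}` of `(G₀ × G₀) × H₁`. -/
structure IsWeakEquivalence : Prop where
  surjective : Function.Surjective (EssFiber.tgt : φ.EssFiber → B.Total)
  submersion : Manifold.IsSubmersion (𝓡 n) (𝓡 n') ∞ (EssFiber.tgt : φ.EssFiber → B.Total)
  embedding : Manifold.IsSmoothEmbedding (𝓡 n) (((𝓡 n).prod (𝓡 n)).prod (𝓡 n')) ∞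
    fun a : A.Arrow => ((a.src, a.tgt), φ.arr a)
  range_eq : Set.range (fun a : A.Arrow => ((a.src, a.tgt), φ.arr a)) =
    {p | (φ.obj p.1.1, φ.obj p.1.2) = (p.2.src, p.2.tgt)}

end Hom

/-- Unit weak equivalences between marked atlas groupoids over the same space `Q`. -/
structure Hom.IsUnitWeakEquivalence {n n' : ℕ} {A : OrbifoldAtlas.{u} n Q}
    {B : OrbifoldAtlas.{u} n' Q} (φ : Hom A B) : Prop where
  isWeakEquivalence : φ.IsWeakEquivalence
  marking_comp : B.marking ∘ φ.orbitMap ∘ A.marking.symm = id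

/-- Quasi-pseudogroups: inverses and composites exist in `P` at the level of germs. -/
structure IsQuasiPseudogroup {M : Type*} [TopologicalSpace M]
    (P : Set (OpenPartialHomeomorph M M)) : Prop where
  inv : ∀ f ∈ P, ∀ x ∈ f.source, ∃ g ∈ P, f x ∈ g.source ∧ (f.symm : M → M) =ᶠ[𝓝 (f x)] g
  comp : ∀ f ∈ P, ∀ g ∈ P, ∀ x ∈ f.source, f x ∈ g.source →
    ∃ h ∈ P, x ∈ h.source ∧ (g ∘ f : M → M) =ᶠ[𝓝 x] h

/-- `P` generates the pseudogroup `R`. For a quasi-pseudogroup `P` the pseudogroup closed under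
restrictions and gluing with this property is unique, so uniqueness is not stated. -/
def Generates {M : Type*} [TopologicalSpace M] (P R : Set (OpenPartialHomeomorph M M)) : Prop :=
  P ⊆ R ∧ ∀ f ∈ R, ∀ x ∈ f.source, ∃ g ∈ P, x ∈ g.source ∧ (f : M → M) =ᶠ[𝓝 x] g

/-- `S` is the domain `W` of some orbifold chart `(W, H, χ)` with `W` open in `∐ V_i` and `χ` the
restriction of the projection: `S` is the image of an open embedding of an orbifold chart `C` that
commutes with the projections. Such a chart is automatically compatible with the atlas. -/
def OrbifoldAtlas.IsChartDomain (B : OrbifoldAtlas.{u} n' Q') (S : Set B.Total) : Prop :=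
  ∃ (C : OrbifoldChart.{u} n' Q') (j : C.V → B.Total),
    IsLocalDiffeomorph (𝓡 n') (𝓡 n') ∞ j ∧ Function.Injective j ∧
      (∀ v, B.proj (j v) = C.π v) ∧ Set.range j = S

/-- Local lifts of `f`. -/
def IsLocalLift (f : Q → Q') (c : OrbifoldChart.{u} n Q) (d : OrbifoldChart.{u} n' Q')
    (g : c.V → d.V) : Prop :=
  ContMDiff (𝓡 n) (𝓡 n') ∞ g ∧ ∀ x, d.π (g x) = f (c.π x)

/-- The map `ψ = ∐ l_i`. -/
def coprodMap {A : OrbifoldAtlas.{u} n Q} {B : OrbifoldAtlas.{u} n' Q'}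
    {τ : A.charts → B.charts} (l : ∀ i : A.charts, i.1.V → (τ i).1.V) (x : A.Total) : B.Total :=
  B.incl (τ x.1) (l x.1 x.2)

/-- A representative `(f, {f_i}, P, ν)` of an orbifold map with domain atlas `A` and range family contained
in `B`. `range i` is the chart in which the lift `f_i` takes values. `P` is a quasi-pseudogroup of
changes of charts (elements of `Ψ(A)` with connected domain) which generates `Ψ(A)`, and `ν` maps
`P` to open embeddings between orbifold charts, regarded as elements of `Ψ(B)`. -/
structure OrbMapRep (A : OrbifoldAtlas.{u} n Q) (B : OrbifoldAtlas.{u} n' Q') where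
  f : Q → Q'
  continuous_f : Continuous f
  range : A.charts → B.charts
  lift : ∀ i : A.charts, i.1.V → (range i).1.V
  isLocalLift : ∀ i, IsLocalLift f i.1 (range i).1 (lift i)
  P : Set (OpenPartialHomeomorph A.Total A.Total)
  quasi : IsQuasiPseudogroup P
  change_of_charts : ∀ l ∈ P, l ∈ A.Psi ∧ IsConnected l.source
  generates : Generates P A.Psi
  ν : P → B.Psi
  ν_chart : ∀ l, B.IsChartDomain (ν l).1.source
  ν_invariant : ∀ (l : P), ∀ x ∈ l.1.source, coprodMap lift x ∈ (ν l).1.source ∧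
    coprodMap lift (l.1 x) = (ν l).1 (coprodMap lift x)
  ν_germ : ∀ (l m : P), ∀ x ∈ l.1.source, x ∈ m.1.source →
    (l.1 : A.Total → A.Total) =ᶠ[𝓝 x] m.1 →
    ((ν l).1 : B.Total → B.Total) =ᶠ[𝓝 (coprodMap lift x)] (ν m).1
  ν_mul : ∀ (l m h : P), ∀ x ∈ l.1.source, l.1 x ∈ m.1.source → x ∈ h.1.source →
    (m.1 ∘ l.1 : A.Total → A.Total) =ᶠ[𝓝 x] h.1 →
    ((ν m).1 ∘ (ν l).1 : B.Total → B.Total) =ᶠ[𝓝 (coprodMap lift x)] (ν h).1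
  ν_unit : ∀ (l : P), ∀ x ∈ l.1.source, (l.1 : A.Total → A.Total) =ᶠ[𝓝 x] id →
    ((ν l).1 : B.Total → B.Total) =ᶠ[𝓝 (coprodMap lift x)] id

namespace OrbMapRep

variable {A : OrbifoldAtlas.{u} n Q} {B : OrbifoldAtlas.{u} n' Q'}

/-- The map `∐ f_i` of the representative. -/
def ψ (r : OrbMapRep A B) : A.Total → B.Total := coprodMap r.lift

/-- Equivalence of representatives. Charts being nonempty, `r.ψ = r'.ψ` says that the families of lifts
coincide. -/
def Equivalent (r r' : OrbMapRep A B) : Prop :=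
  r.f = r'.f ∧ r.ψ = r'.ψ ∧ ∀ (l : r.P) (l' : r'.P), ∀ x ∈ l.1.source, x ∈ l'.1.source →
    (l.1 : A.Total → A.Total) =ᶠ[𝓝 x] l'.1 →
    ((r.ν l).1 : B.Total → B.Total) =ᶠ[𝓝 (r.ψ x)] (r'.ν l').1

lemma exists_mem_P (r : OrbMapRep A B) {f : OpenPartialHomeomorph A.Total A.Total}
    (hf : f ∈ A.Psi) {x : A.Total} (hx : x ∈ f.source) :
    ∃ l : r.P, x ∈ l.1.source ∧ (f : A.Total → A.Total) =ᶠ[𝓝 x] l.1 := by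
  obtain ⟨g, hg, hgx, h⟩ := r.generates.2 f hf x hx
  exact ⟨⟨g, hg⟩, hgx, h⟩

instance setoid (A : OrbifoldAtlas.{u} n Q) (B : OrbifoldAtlas.{u} n' Q') :
    Setoid (OrbMapRep A B) where
  r := Equivalent
  iseqv :=
    { refl := fun r => ⟨rfl, rfl, r.ν_germ⟩
      symm := fun {r s} h => ⟨h.1.symm, h.2.1.symm, fun l l' x hx hx' e => by
        rw [← h.2.1]; exact (h.2.2 l' l x hx' hx e.symm).symm⟩
      trans := fun {r s t} h k => ⟨h.1.trans k.1, h.2.1.trans k.2.1, fun l l' x hx hx' e => by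
        obtain ⟨m, hm, em⟩ := s.exists_mem_P (r.change_of_charts l.1 l.2).1 hx
        refine (h.2.2 l m x hx hm em).trans ?_
        rw [h.2.1]
        exact k.2.2 m l' x hm hx' (em.symm.trans e)⟩ }

lemma contMDiff_ψ (r : OrbMapRep A B) : ContMDiff (𝓡 n) (𝓡 n') ∞ r.ψ := by
  rintro ⟨c, x⟩
  have hc : A.incl c x ∈ (A.inclHomeo c).target := ⟨x, trivial, rfl⟩
  have h1 : ContMDiffAt (𝓡 n) (𝓡 n) ∞ (A.inclHomeo c).symm (A.incl c x) :=
    (A.contMDiffOn_inclHomeo_symm c).contMDiffAt ((A.inclHomeo c).open_target.mem_nhds hc)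
  have h2 := ((B.contMDiff_incl (r.range c)).comp (r.isLocalLift c).1).contMDiffAt.comp _ h1
  refine h2.congr_of_eventuallyEq ?_
  filter_upwards [(A.inclHomeo c).open_target.mem_nhds hc] with p hp
  obtain ⟨y, -, rfl⟩ := hp
  have hl : (A.inclHomeo c).symm (A.incl c y) = y :=
    (A.inclHomeo c).left_inv (Set.mem_univ y)
  simp only [Function.comp_apply]
  change r.ψ (A.incl c y) = B.incl (r.range c) (r.lift c ((A.inclHomeo c).symm (A.incl c y)))
  rw [hl]
  rfl

/-- An element of `P` with the germ `a`. -/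
def pick (r : OrbMapRep A B) (a : A.Arrow) : r.P :=
  (r.exists_mem_P a.rep_mem a.src_mem).choose

lemma pick_mem (r : OrbMapRep A B) (a : A.Arrow) : a.src ∈ (r.pick a).1.source :=
  (r.exists_mem_P a.rep_mem a.src_mem).choose_spec.1

lemma rep_eq_pick (r : OrbMapRep A B) (a : A.Arrow) :
    (a.rep : A.Total → A.Total) =ᶠ[𝓝 a.src] (r.pick a).1 :=
  (r.exists_mem_P a.rep_mem a.src_mem).choose_spec.2

/-- The map `germ_x λ ↦ germ_{ψ x} ν(λ)` for `λ ∈ P`, see `arr_germ`. -/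
def arr (r : OrbMapRep A B) (a : A.Arrow) : B.Arrow :=
  OrbifoldAtlas.germ (r.ν (r.pick a)).2 (r.ψ a.src) (r.ν_invariant _ _ (r.pick_mem a)).1

lemma arr_germ (r : OrbMapRep A B) (l : r.P) (x : A.Total) (hx : x ∈ l.1.source) :
    r.arr (OrbifoldAtlas.germ (r.change_of_charts l.1 l.2).1 x hx) =
      OrbifoldAtlas.germ (r.ν l).2 (r.ψ x) (r.ν_invariant l x hx).1 := by
  refine OrbifoldAtlas.germ_eq_germ.2 ⟨rfl, ?_⟩
  refine r.ν_germ _ _ x (r.pick_mem _) hx ?_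
  exact (r.rep_eq_pick _).symm.trans (OrbifoldAtlas.Arrow.rep_germ _ x hx)

lemma exists_germ (r : OrbMapRep A B) (a : A.Arrow) : ∃ (l : r.P) (x : A.Total)
    (hx : x ∈ l.1.source), a = OrbifoldAtlas.germ (r.change_of_charts l.1 l.2).1 x hx :=
  ⟨r.pick a, a.src, r.pick_mem a, a.germ_rep.symm.trans
    (OrbifoldAtlas.germ_eq_germ.2 ⟨rfl, r.rep_eq_pick a⟩)⟩

lemma continuous_arr (r : OrbMapRep A B) : Continuous r.arr := by
  rw [continuous_iff_continuousAt]
  intro a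
  obtain ⟨l, x, hx, rfl⟩ := r.exists_germ a
  have hl := (r.change_of_charts l.1 l.2).1
  have hU : OrbifoldAtlas.Arrow.basic hl ∈ 𝓝 (OrbifoldAtlas.germ hl x hx) :=
    (OrbifoldAtlas.Arrow.isOpen_basic hl).mem_nhds ⟨x, hx, rfl⟩
  have h : ContinuousOn ((OrbifoldAtlas.Arrow.chart (r.ν l).2).symm ∘ r.ψ ∘
      OrbifoldAtlas.Arrow.chart hl) (OrbifoldAtlas.Arrow.basic hl) := by
    refine (OrbifoldAtlas.Arrow.chart (r.ν l).2).continuousOn_symm.comp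
      (r.contMDiff_ψ.continuous.comp_continuousOn (OrbifoldAtlas.Arrow.chart hl).continuousOn) ?_
    rintro _ ⟨y, hy, rfl⟩
    exact (r.ν_invariant l y hy).1
  refine (h.continuousAt hU).congr ?_
  filter_upwards [hU] with b hb
  obtain ⟨y, hy, rfl⟩ := hb
  rw [r.arr_germ l y hy]
  exact dif_pos (r.ν_invariant l y hy).1

lemma contMDiff_arr (r : OrbMapRep A B) : ContMDiff (𝓡 n) (𝓡 n') ∞ r.arr := by
  intro a
  have h := r.contMDiff_ψ a.src
  rw [contMDiffAt_iff] at h ⊢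
  refine ⟨r.continuous_arr.continuousAt, ?_⟩
  have key : extChartAt (𝓡 n') (r.arr a) ∘ r.arr ∘ (extChartAt (𝓡 n) a).symm =
      extChartAt (𝓡 n') (r.ψ a.src) ∘ r.ψ ∘ (extChartAt (𝓡 n) a.src).symm := by
    funext y
    change extChartAt (𝓡 n') (r.ψ a.src) (r.ψ (OrbifoldAtlas.Arrow.src
      ((OrbifoldAtlas.Arrow.chart a.rep_mem).symm ((extChartAt (𝓡 n) a.src).symm y)))) = _
    rw [OrbifoldAtlas.Arrow.src_chart_symm]
    rfl
  rw [key]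
  exact h.2

/-- The homomorphism `(ψ, germ_x λ ↦ germ_{ψ x} ν(λ))` of the atlas groupoids. -/
def toHom (r : OrbMapRep A B) : Hom A B where
  obj := r.ψ
  arr := r.arr
  smooth_obj := r.contMDiff_ψ
  smooth_arr := r.contMDiff_arr
  map_src _ := rfl
  map_tgt a := by
    obtain ⟨l, x, hx, rfl⟩ := r.exists_germ a
    rw [r.arr_germ l x hx]
    exact (r.ν_invariant l x hx).2.symm
  map_mul b a h := by
    obtain ⟨l, x, hx, rfl⟩ := r.exists_germ a
    obtain ⟨m, y, hy, rfl⟩ := r.exists_germ b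
    obtain rfl : y = l.1 x := h
    obtain ⟨k, hk, hkx, e⟩ := r.quasi.comp l.1 l.2 m.1 m.2 x hx hy
    have h1 : OrbifoldAtlas.Arrow.mul
        (OrbifoldAtlas.germ (r.change_of_charts m.1 m.2).1 (l.1 x) hy)
        (OrbifoldAtlas.germ (r.change_of_charts l.1 l.2).1 x hx) rfl =
        OrbifoldAtlas.germ (r.change_of_charts k hk).1 x hkx :=
      (OrbifoldAtlas.Arrow.mul_germ _ _ x hx hy rfl).trans
        (OrbifoldAtlas.germ_eq_germ.2 ⟨rfl, e⟩)
    have hm : (r.ν l).1 (r.ψ x) ∈ (r.ν m).1.source := by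
      have := (r.ν_invariant m _ hy).1
      rwa [(r.ν_invariant l x hx).2] at this
    have h2 : r.arr (OrbifoldAtlas.germ (r.change_of_charts m.1 m.2).1 (l.1 x) hy) =
        OrbifoldAtlas.germ (r.ν m).2 ((r.ν l).1 (r.ψ x)) hm :=
      (r.arr_germ m _ hy).trans (OrbifoldAtlas.germ_eq_germ.2
        ⟨(r.ν_invariant l x hx).2, Filter.EventuallyEq.rfl⟩)
    simp only [h1, h2, r.arr_germ l x hx, r.arr_germ ⟨k, hk⟩ x hkx]
    exact (OrbifoldAtlas.germ_eq_germ.2 ⟨rfl, (r.ν_mul l m ⟨k, hk⟩ x hx hy hkx e).symm⟩).trans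
      (OrbifoldAtlas.Arrow.mul_germ (r.ν l).2 (r.ν m).2 (r.ψ x) _ hm rfl).symm
  map_unit x := by
    refine OrbifoldAtlas.germ_eq_germ.2 ⟨rfl, ?_⟩
    refine r.ν_unit _ x (r.pick_mem _) ?_
    exact (r.rep_eq_pick _).symm.trans (OrbifoldAtlas.Arrow.rep_germ _ x _)
  map_inv a := by
    obtain ⟨l, x, hx, rfl⟩ := r.exists_germ a
    obtain ⟨g, hg, hgx, e⟩ := r.quasi.inv l.1 l.2 x hx
    have h1 : OrbifoldAtlas.Arrow.inv (OrbifoldAtlas.germ (r.change_of_charts l.1 l.2).1 x hx) =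
        OrbifoldAtlas.germ (r.change_of_charts g hg).1 (l.1 x) hgx :=
      OrbifoldAtlas.germ_eq_germ.2 ⟨rfl, e⟩
    rw [h1, r.arr_germ l x hx, r.arr_germ ⟨g, hg⟩ _ hgx]
    obtain ⟨hs, hi⟩ := r.ν_invariant l x hx
    refine OrbifoldAtlas.germ_eq_germ.2 ⟨hi, ?_⟩
    obtain ⟨k, hk, hkx, e'⟩ := r.quasi.comp l.1 l.2 g hg x hx hgx
    have hgl : (g ∘ l.1 : A.Total → A.Total) =ᶠ[𝓝 x] id := by
      filter_upwards [(l.1.continuousAt hx).eventually e, l.1.open_source.mem_nhds hx] with z hz hz'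
      rw [Function.comp_apply, ← hz, l.1.left_inv hz', id]
    have hν := (r.ν_mul l ⟨g, hg⟩ ⟨k, hk⟩ x hx hgx hkx e').trans
      (r.ν_unit ⟨k, hk⟩ x hkx (e'.symm.trans hgl))
    change ((r.ν ⟨g, hg⟩).1 : B.Total → B.Total) =ᶠ[𝓝 (coprodMap r.lift (l.1 x))] (r.ν l).1.symm
    rw [hi]
    have hc : Filter.Tendsto (r.ν l).1.symm (𝓝 ((r.ν l).1 (coprodMap r.lift x)))
        (𝓝 (coprodMap r.lift x)) := by
      have := (r.ν l).1.symm.continuousAt ((r.ν l).1.map_source hs)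
      rwa [ContinuousAt, (r.ν l).1.left_inv hs] at this
    filter_upwards [hc.eventually hν, (r.ν l).1.open_target.mem_nhds ((r.ν l).1.map_source hs)]
      with z hz hz'
    simpa [(r.ν l).1.right_inv hz'] using hz

lemma toHom_eq_of_equivalent {r r' : OrbMapRep A B} (h : r.Equivalent r') :
    r.toHom = r'.toHom := by
  have h1 : r.arr = r'.arr := by
    funext a
    refine OrbifoldAtlas.germ_eq_germ.2 ⟨congrFun h.2.1 _, ?_⟩
    exact h.2.2 _ _ a.src (r.pick_mem a) (r'.pick_mem a)
      ((r.rep_eq_pick a).symm.trans (r'.rep_eq_pick a))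
  have h0 := h.2.1
  simp only [toHom, h0, h1]

end OrbMapRep

/-- The set of orbifold maps with domain atlas `A` and range atlas `B`. -/
def OrbMap (A : OrbifoldAtlas.{u} n Q) (B : OrbifoldAtlas.{u} n' Q') : Type _ :=
  Quotient (OrbMapRep.setoid A B)

/-- The map `F₁` from charted orbifold maps to homomorphisms. -/
def F₁ {A : OrbifoldAtlas.{u} n Q} {B : OrbifoldAtlas.{u} n' Q'} (f : OrbMap A B) : Hom A B :=
  Quotient.lift OrbMapRep.toHom (fun _ _ => OrbMapRep.toHom_eq_of_equivalent) f

lemma OrbifoldChart.π_eq_iff (c : OrbifoldChart.{u} n Q) (x y : c.V) :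
    c.π x = c.π y ↔ ∃ g ∈ c.G, g y = x := by
  obtain ⟨h, hh⟩ := c.induces_homeo
  rw [← hh x, ← hh y, Subtype.coe_inj, h.injective.eq_iff, Quotient.eq, MulAction.orbitRel_apply]
  constructor
  · rintro ⟨g, hg⟩
    exact ⟨g.1, g.2, hg⟩
  · rintro ⟨g, hg, e⟩
    exact ⟨⟨g, hg⟩, e⟩

lemma OrbifoldChart.exists_stable (c : OrbifoldChart.{u} n Q) {W : Set c.V} (hW : IsOpen W)
    {v : c.V} (hv : v ∈ W) : ∃ S : TopologicalSpace.Opens c.V, v ∈ S ∧ (S : Set c.V) ⊆ W ∧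
      IsConnected (S : Set c.V) ∧
      ∀ g ∈ c.G, (∃ s ∈ S, g s ∈ S) → ∀ s ∈ S, g s ∈ S := by
  have hloc : LocallyConnectedSpace c.V :=
    ChartedSpace.locallyConnectedSpace (EuclideanSpace ℝ (Fin n)) c.V
  have hfin : Finite c.G := c.finite_G
  have hcont : ∀ g : c.G, Continuous (g.1 : c.V → c.V) := fun g =>
    (c.smooth_G g.1 g.2).continuous
  have hO : ∀ g : c.G, ∃ O : Set c.V, IsOpen O ∧ v ∈ O ∧
      (g.1 v ≠ v → ∀ x ∈ O, g.1 x ∉ O) := by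
    intro g
    by_cases hg : g.1 v = v
    · exact ⟨Set.univ, isOpen_univ, trivial, fun h => absurd hg h⟩
    · obtain ⟨a, b, ha, hb, hva, hvb, hab⟩ := t2_separation hg
      refine ⟨b ∩ g.1 ⁻¹' a, hb.inter (ha.preimage (hcont g)), ⟨hvb, hva⟩, ?_⟩
      rintro - x ⟨-, hx⟩ ⟨hx', -⟩
      exact Set.disjoint_left.1 hab hx hx'
  choose O hOo hOv hOd using hO
  let N : Set c.V := W ∩ ⋂ g : c.G, O g
  have hN : IsOpen N := hW.inter (isOpen_iInter_of_finite hOo)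
  let N' : Set c.V := ⋂ g : {g : c.G // g.1 v = v}, g.1.1 ⁻¹' N
  have hN' : IsOpen N' := isOpen_iInter_of_finite fun g => hN.preimage (hcont g.1)
  have hvN : v ∈ N := ⟨hv, Set.mem_iInter.2 hOv⟩
  have hvN' : v ∈ N' := Set.mem_iInter.2 fun g => by
    change g.1.1 v ∈ N
    rw [g.2]
    exact hvN
  have hN'N : N' ⊆ N := fun x hx => Set.mem_iInter.1 hx ⟨1, rfl⟩
  have hS := connectedComponentIn_subset N' v
  refine ⟨⟨connectedComponentIn N' v, hN'.connectedComponentIn⟩, mem_connectedComponentIn hvN',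
    fun x hx => (hN'N (hS hx)).1, isConnected_connectedComponentIn_iff.2 hvN', ?_⟩
  rintro g hg ⟨s, hs, hgs⟩
  have hgv : g v = v := by
    by_contra hne
    exact hOd ⟨g, hg⟩ hne s (Set.mem_iInter.1 (hN'N (hS hs)).2 _)
      (Set.mem_iInter.1 (hN'N (hS hgs)).2 _)
  have hmaps : ∀ x ∈ N', g x ∈ N' := fun x hx => Set.mem_iInter.2 fun k => by
    have hk : (k.1 * ⟨g, hg⟩ : c.G).1 v = v := by
      change k.1.1 (g v) = v
      rw [hgv, k.2]
    exact Set.mem_iInter.1 hx ⟨k.1 * ⟨g, hg⟩, hk⟩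
  have hpre : IsPreconnected (g '' connectedComponentIn N' v) :=
    isPreconnected_connectedComponentIn.image _ (hcont ⟨g, hg⟩).continuousOn
  have hsub : g '' connectedComponentIn N' v ⊆ connectedComponentIn N' (g v) := hpre.subset_connectedComponentIn
    (Set.mem_image_of_mem g (mem_connectedComponentIn hvN'))
    (Set.image_subset_iff.2 fun x hx => hmaps x (hS hx))
  intro x hx
  have := hsub (Set.mem_image_of_mem g hx)
  rwa [hgv] at this

/-- The restriction of an orbifold chart to a stable connected open subset. -/
def OrbifoldChart.restrict (c : OrbifoldChart.{u} n Q) (S : TopologicalSpace.Opens c.V)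
    (hS : IsConnected (S : Set c.V))
    (hst : ∀ g ∈ c.G, (∃ s ∈ S, g s ∈ S) → ∀ s ∈ S, g s ∈ S) : OrbifoldChart.{u} n Q :=
  let G' : Subgroup (Equiv.Perm S) :=
    { carrier := {σ | ∃ g ∈ c.G, ∀ s : S, (σ s : c.V) = g s}
      mul_mem' := by
        rintro σ τ ⟨g, hg, h⟩ ⟨k, hk, h'⟩
        exact ⟨g * k, mul_mem hg hk, fun s => by simp [h, h']⟩
      one_mem' := ⟨1, one_mem _, fun s => rfl⟩
      inv_mem' := by
        rintro σ ⟨g, hg, h⟩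
        refine ⟨g⁻¹, inv_mem hg, fun s => ?_⟩
        rw [Equiv.Perm.eq_inv_iff_eq, ← h]
        simp }
  { V := S
    connectedV := isConnected_iff_connectedSpace.1 hS
    G := G'
    finite_G := by
      have hfin : Finite c.G := c.finite_G
      choose g hg h using fun σ : G' => σ.2
      refine Finite.of_injective (fun σ => (⟨g σ, hg σ⟩ : c.G)) fun σ τ e => ?_
      have e' : g σ = g τ := congrArg Subtype.val e
      refine Subtype.ext (Equiv.ext fun s => Subtype.ext ?_)
      rw [h σ s, h τ s, e']
    smooth_G := by
      rintro σ ⟨g, hg, h⟩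
      rw [← ContMDiff.subtypeVal_comp_iff]
      have : Subtype.val ∘ (σ : S → S) = g ∘ Subtype.val := funext h
      rw [this]
      exact (c.smooth_G g hg).comp contMDiff_subtype_val
    π := fun s => c.π s
    isOpen_range := by
      have := (c.isOpenMap_π.comp S.2.isOpenMap_subtype_val).isOpen_range
      exact this
    induces_homeo := by
      let p : S → Q := fun s => c.π s
      have hp : Continuous p := c.continuous_π.comp continuous_subtype_val
      have ho : IsOpenMap p := c.isOpenMap_π.comp S.2.isOpenMap_subtype_val
      have hrel : ∀ s t : S, p s = p t ↔ MulAction.orbitRel G' S s t := by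
        intro s t
        rw [MulAction.orbitRel_apply]
        constructor
        · intro e
          obtain ⟨g, hg, hgt⟩ := (c.π_eq_iff _ _).1 e
          have h1 := hst g hg ⟨t, t.2, hgt ▸ s.2⟩
          have h2 := hst g⁻¹ (inv_mem hg) ⟨s, s.2, by rw [← hgt]; simp⟩
          let σ : Equiv.Perm S :=
            { toFun := fun x => ⟨g x, h1 x x.2⟩
              invFun := fun x => ⟨g⁻¹ x, h2 x x.2⟩
              left_inv := fun x => Subtype.ext (by simp)
              right_inv := fun x => Subtype.ext (by simp) }
          exact ⟨⟨σ, g, hg, fun _ => rfl⟩, Subtype.ext hgt⟩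
        · rintro ⟨⟨σ, g, hg, h⟩, e⟩
          refine (c.π_eq_iff _ _).2 ⟨g, hg, ?_⟩
          rw [← h t]
          exact congrArg Subtype.val e
      let q : Quotient (MulAction.orbitRel G' S) → Set.range p :=
        Quotient.lift (Set.rangeFactorization p) fun s t h => Subtype.ext ((hrel s t).2 h)
      have hq : Function.Bijective q := by
        constructor
        · intro a b
          induction a using Quotient.inductionOn with | h x => ?_
          induction b using Quotient.inductionOn with | h y => ?_
          intro h
          exact Quotient.sound ((hrel x y).1 (congrArg Subtype.val h))
        · rintro ⟨_, s, rfl⟩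
          exact ⟨Quotient.mk _ s, rfl⟩
      have hqc : Continuous q := (hp.subtype_mk _).quotient_lift _
      have hqo : IsOpenMap q := by
        intro t ht
        have h1 : IsOpen (p '' (Quotient.mk _ ⁻¹' t)) :=
          ho _ (ht.preimage continuous_quotient_mk')
        have h2 : q '' t = Subtype.val ⁻¹' (p '' (Quotient.mk _ ⁻¹' t)) := by
          ext z
          constructor
          · rintro ⟨a, ha, rfl⟩
            induction a using Quotient.inductionOn with | h x => ?_
            exact ⟨x, ha, rfl⟩
          · rintro ⟨x, hx, e⟩
            exact ⟨_, hx, Subtype.ext e⟩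
        rw [h2]
        exact h1.preimage continuous_subtype_val
      exact ⟨(Equiv.ofBijective q hq).toHomeomorphOfContinuousOpen hqc hqo, fun _ => rfl⟩ }

lemma OrbifoldAtlas.exists_chartDomain (B : OrbifoldAtlas.{u} n Q) {W : Set B.Total}
    (hW : IsOpen W) {y : B.Total} (hy : y ∈ W) : ∃ S, B.IsChartDomain S ∧ y ∈ S ∧ S ⊆ W := by
  obtain ⟨c, v⟩ := y
  obtain ⟨S, hvS, hSW, hconn, hst⟩ := c.1.exists_stable
    (hW.preimage (B.isOpenEmbedding_incl c).continuous) hy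
  refine ⟨B.incl c '' S, ⟨c.1.restrict S hconn hst, fun s : S => B.incl c s.1, ?_, ?_, ?_, ?_⟩,
    ⟨v, hvS, rfl⟩, Set.image_subset_iff.2 hSW⟩
  · intro s
    have hne : Nonempty S := ⟨s⟩
    let e := (S.openPartialHomeomorphSubtypeCoe hne).trans (B.inclHomeo c)
    have hl : ∀ z : c.1.V, (B.inclHomeo c).symm (B.incl c z) = z := fun z =>
      (B.inclHomeo c).left_inv (Set.mem_univ z)
    have het : ∀ p ∈ e.target, ∃ s : S, B.incl c s.1 = p := by
      intro p hp
      exact ⟨e.symm p, e.right_inv hp⟩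
    refine ⟨{ toPartialEquiv := e.toPartialEquiv
              open_source := e.open_source
              open_target := e.open_target
              contMDiffOn_toFun := ?_
              contMDiffOn_invFun := ?_ }, ?_, ?_⟩
    · exact ((B.contMDiff_incl c).comp contMDiff_subtype_val).contMDiffOn
    · intro p hp
      refine (ContMDiffWithinAt.subtypeVal_comp_iff S e.symm _ p).1 ?_
      refine (((B.contMDiffOn_inclHomeo_symm c).mono (t := e.target) ?_).congr ?_) p hp
      · intro p hp
        obtain ⟨s, rfl⟩ := het p hp
        exact ⟨s.1, trivial, rfl⟩
      · intro p hp
        obtain ⟨s, rfl⟩ := het p hp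
        have h1 : e.symm (e s) = s := e.left_inv (by simp [e, inclHomeo])
        change ((e.symm (e s)).1 : c.1.V) = _
        rw [h1, hl]
    · exact ⟨trivial, trivial⟩
    · intro _ _
      rfl
  · exact (B.isOpenEmbedding_incl c).injective.comp Subtype.val_injective
  · intro s
    rfl
  · change Set.range (B.incl c ∘ Subtype.val) = _
    rw [Set.range_comp, Subtype.range_coe]

lemma OrbifoldAtlas.IsChartDomain.isOpen {B : OrbifoldAtlas.{u} n Q} {S : Set B.Total}
    (h : B.IsChartDomain S) : IsOpen S := by
  obtain ⟨C, j, hj, -, -, rfl⟩ := h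
  exact hj.isOpen_range

namespace Hom

variable {A : OrbifoldAtlas.{u} n Q} {B : OrbifoldAtlas.{u} n' Q'} (φ : Hom A B)

lemma continuous_orbitMap : Continuous φ.orbitMap :=
  Continuous.quotient_lift (continuous_quotient_mk'.comp φ.smooth_obj.continuous) _

/-- The map `α_B ∘ |φ| ∘ α_A⁻¹`. -/
def baseMap (φ : Hom A B) : Q → Q' := B.marking ∘ φ.orbitMap ∘ A.marking.symm

lemma continuous_baseMap : Continuous φ.baseMap :=
  B.marking.continuous.comp (φ.continuous_orbitMap.comp A.marking.symm.continuous)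

lemma baseMap_proj (x : A.Total) : φ.baseMap (A.proj x) = B.proj (φ.obj x) := by
  have h : A.marking.symm (A.proj x) = (Quotient.mk A.orbitSetoid x : A.OrbitSpace) :=
    A.marking.symm_apply_eq.2 rfl
  simp only [baseMap, Function.comp_apply, h]
  rfl

lemma exists_component (i : A.charts) : ∃ (j : B.charts) (g : i.1.V → j.1.V),
    ∀ x, φ.obj (A.incl i x) = B.incl j (g x) := by
  have hc : Continuous (fun x => φ.obj (A.incl i x)) :=
    φ.smooth_obj.continuous.comp (A.isOpenEmbedding_incl i).continuous
  obtain ⟨j, g, -, h⟩ := Continuous.exists_lift_sigma (X := fun j : B.charts => j.1.V) hc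
  exact ⟨j, g, fun x => congrFun h x⟩

/-- The chart of `B` that contains the image of the (connected) component `V_i`. -/
def component (i : A.charts) : B.charts := (φ.exists_component i).choose

/-- The restriction of `φ₀` to `V_i`. -/
def restr (i : A.charts) : i.1.V → (φ.component i).1.V :=
  (φ.exists_component i).choose_spec.choose

lemma obj_incl (i : A.charts) (x : i.1.V) :
    φ.obj (A.incl i x) = B.incl (φ.component i) (φ.restr i x) :=
  (φ.exists_component i).choose_spec.choose_spec x

lemma contMDiff_restr (i : A.charts) : ContMDiff (𝓡 n) (𝓡 n') ∞ (φ.restr i) := by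
  have h : ContMDiff (𝓡 n) (𝓡 n') ∞
      ((B.inclHomeo (φ.component i)).symm ∘ fun x => φ.obj (A.incl i x)) :=
    (B.contMDiffOn_inclHomeo_symm (φ.component i)).comp_contMDiff
      (φ.smooth_obj.comp (A.contMDiff_incl i)) fun x =>
        ⟨φ.restr i x, trivial, (φ.obj_incl i x).symm⟩
  have e : (B.inclHomeo (φ.component i)).symm ∘ (fun x => φ.obj (A.incl i x)) = φ.restr i := by
    funext x
    rw [Function.comp_apply, φ.obj_incl]
    exact (B.inclHomeo (φ.component i)).left_inv (Set.mem_univ _)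
  rwa [e] at h

lemma coprodMap_restr : coprodMap φ.restr = φ.obj :=
  funext fun x => (φ.obj_incl x.1 x.2).symm

/-- `φ₁(germ_x l) = germ_{φ₀ x} g` for all `x ∈ dom l`. -/
def Transports {l : OpenPartialHomeomorph A.Total A.Total} (hl : l ∈ A.Psi)
    {g : OpenPartialHomeomorph B.Total B.Total} (hg : g ∈ B.Psi) : Prop :=
  ∀ (x : A.Total) (hx : x ∈ l.source), ∃ h : φ.obj x ∈ g.source,
    φ.arr (OrbifoldAtlas.germ hl x hx) = OrbifoldAtlas.germ hg (φ.obj x) h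

/-- The changes of charts `l` that are transported by `φ` to an open embedding of orbifold charts. -/
def quasiPseudogroup : Set (OpenPartialHomeomorph A.Total A.Total) :=
  {l | IsConnected l.source ∧ ∃ hl : l ∈ A.Psi, ∃ g : B.Psi,
    B.IsChartDomain g.1.source ∧ φ.Transports hl g.2}

lemma exists_mem_quasiPseudogroup {f : OpenPartialHomeomorph A.Total A.Total} (hf : f ∈ A.Psi)
    {x : A.Total} (hx : x ∈ f.source) :
    ∃ l ∈ φ.quasiPseudogroup, x ∈ l.source ∧ (f : A.Total → A.Total) =ᶠ[𝓝 x] l := by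
  have hloc : LocallyConnectedSpace A.Total :=
    ChartedSpace.locallyConnectedSpace (EuclideanSpace ℝ (Fin n)) A.Total
  set b := φ.arr (OrbifoldAtlas.germ hf x hx) with hb
  obtain ⟨S, hS, hbS, hSs⟩ := B.exists_chartDomain b.rep.open_source b.src_mem
  have hg : b.rep.restrOpen S hS.isOpen ∈ B.Psi := OrbifoldAtlas.restr_mem_Psi b.rep_mem hS.isOpen
  have hsrc : (b.rep.restrOpen S hS.isOpen).source = S := by
    rw [OpenPartialHomeomorph.restrOpen_source]
    exact Set.inter_eq_right.2 hSs
  have hbg : b ∈ OrbifoldAtlas.Arrow.basic hg := by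
    refine ⟨b.src, ⟨b.src_mem, hbS⟩, ?_⟩
    exact b.germ_rep.symm.trans (OrbifoldAtlas.germ_eq_germ.2 ⟨rfl, Filter.EventuallyEq.rfl⟩)
  have hopen : IsOpen (φ.arr ⁻¹' OrbifoldAtlas.Arrow.basic hg) :=
    (OrbifoldAtlas.Arrow.isOpen_basic hg).preimage φ.smooth_arr.continuous
  let W : Set A.Total := f.source ∩ (OrbifoldAtlas.Arrow.chart hf).symm ⁻¹'
    (φ.arr ⁻¹' OrbifoldAtlas.Arrow.basic hg)
  have hW : IsOpen W := (OrbifoldAtlas.Arrow.chart hf).symm.isOpen_inter_preimage hopen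
  have hchart : ∀ (y : A.Total) (hy : y ∈ f.source),
      (OrbifoldAtlas.Arrow.chart hf).symm y = OrbifoldAtlas.germ hf y hy := fun y hy => dif_pos hy
  have hxW : x ∈ W := ⟨hx, by
    rw [Set.mem_preimage, hchart x hx]
    exact hbg⟩
  have hU := connectedComponentIn_subset W x
  have hUo : IsOpen (connectedComponentIn W x) := hW.connectedComponentIn
  have hls : (f.restrOpen _ hUo).source = connectedComponentIn W x := by
    rw [OpenPartialHomeomorph.restrOpen_source]
    exact Set.inter_eq_right.2 fun y hy => (hU hy).1
  refine ⟨f.restrOpen _ hUo, ⟨?_, OrbifoldAtlas.restr_mem_Psi hf hUo,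
    ⟨_, hg⟩, by rw [hsrc]; exact hS, ?_⟩, ?_, Filter.EventuallyEq.rfl⟩
  · rw [hls]
    exact isConnected_connectedComponentIn_iff.2 hxW
  · intro y hy
    obtain ⟨hyf, hyW⟩ := hU (hls ▸ hy)
    rw [Set.mem_preimage, hchart y hyf] at hyW
    obtain ⟨z, hz, e⟩ := hyW
    have hzy : z = φ.obj y :=
      (congrArg OrbifoldAtlas.Arrow.src e).symm.trans (φ.map_src _)
    subst hzy
    refine ⟨hz, Eq.trans (congrArg φ.arr ?_) e⟩
    exact OrbifoldAtlas.germ_eq_germ.2 ⟨rfl, Filter.EventuallyEq.rfl⟩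
  · rw [hls]
    exact mem_connectedComponentIn hxW

lemma mem_Psi_of_mem (l : φ.quasiPseudogroup) : l.1 ∈ A.Psi := l.2.2.1

/-- The open embedding `ν(l)` attached to `l`. -/
def transport (l : φ.quasiPseudogroup) : B.Psi := l.2.2.2.choose

lemma transport_chart (l : φ.quasiPseudogroup) : B.IsChartDomain (φ.transport l).1.source :=
  l.2.2.2.choose_spec.1

lemma transports (l : φ.quasiPseudogroup) : φ.Transports (φ.mem_Psi_of_mem l) (φ.transport l).2 :=
  l.2.2.2.choose_spec.2

/-- The representative of an orbifold map induced by the homomorphism `φ`. -/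
def toOrbMapRep : OrbMapRep A B where
  f := φ.baseMap
  continuous_f := φ.continuous_baseMap
  range := φ.component
  lift := φ.restr
  isLocalLift i := ⟨φ.contMDiff_restr i, fun x => by
    have h := φ.baseMap_proj (A.incl i x)
    rw [φ.obj_incl] at h
    exact h.symm⟩
  P := φ.quasiPseudogroup
  quasi :=
    { inv := fun f hf x hx => φ.exists_mem_quasiPseudogroup
        (OrbifoldAtlas.symm_mem_Psi (φ.mem_Psi_of_mem ⟨f, hf⟩)) (f.map_source hx)
      comp := fun f hf g hg x hx hfx => φ.exists_mem_quasiPseudogroup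
        (OrbifoldAtlas.trans_mem_Psi (φ.mem_Psi_of_mem ⟨f, hf⟩) (φ.mem_Psi_of_mem ⟨g, hg⟩))
        (by rw [OpenPartialHomeomorph.trans_source]; exact ⟨hx, hfx⟩) }
  change_of_charts l hl := ⟨φ.mem_Psi_of_mem ⟨l, hl⟩, hl.1⟩
  generates := ⟨fun l hl => φ.mem_Psi_of_mem ⟨l, hl⟩,
    fun _ hf _ hx => φ.exists_mem_quasiPseudogroup hf hx⟩
  ν := φ.transport
  ν_chart := φ.transport_chart
  ν_invariant l x hx := by
    rw [φ.coprodMap_restr]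
    obtain ⟨h, e⟩ := φ.transports l x hx
    exact ⟨h, (φ.map_tgt _).symm.trans (congrArg OrbifoldAtlas.Arrow.tgt e)⟩
  ν_germ l m x hx hx' e := by
    rw [φ.coprodMap_restr]
    obtain ⟨h, e1⟩ := φ.transports l x hx
    obtain ⟨h', e2⟩ := φ.transports m x hx'
    have e3 : OrbifoldAtlas.germ (φ.mem_Psi_of_mem l) x hx =
      OrbifoldAtlas.germ (φ.mem_Psi_of_mem m) x hx' := OrbifoldAtlas.germ_eq_germ.2 ⟨rfl, e⟩
    exact (OrbifoldAtlas.germ_eq_germ.1 (e1.symm.trans ((congrArg φ.arr e3).trans e2))).2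
  ν_mul l m k x hx hlx hkx e := by
    rw [φ.coprodMap_restr]
    obtain ⟨h1, e1⟩ := φ.transports l x hx
    obtain ⟨h2, e2⟩ := φ.transports m (l.1 x) hlx
    obtain ⟨h3, e3⟩ := φ.transports k x hkx
    have hi : φ.obj (l.1 x) = (φ.transport l).1 (φ.obj x) :=
      (φ.map_tgt (OrbifoldAtlas.germ (φ.mem_Psi_of_mem l) x hx)).symm.trans
        (congrArg OrbifoldAtlas.Arrow.tgt e1)
    have h2' : (φ.transport l).1 (φ.obj x) ∈ (φ.transport m).1.source := hi ▸ h2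
    have e2' : φ.arr (OrbifoldAtlas.germ (φ.mem_Psi_of_mem m) (l.1 x) hlx) =
        OrbifoldAtlas.germ (φ.transport m).2 ((φ.transport l).1 (φ.obj x)) h2' :=
      e2.trans (OrbifoldAtlas.germ_eq_germ.2 ⟨hi, Filter.EventuallyEq.rfl⟩)
    have hm : OrbifoldAtlas.Arrow.mul (OrbifoldAtlas.germ (φ.mem_Psi_of_mem m) (l.1 x) hlx)
        (OrbifoldAtlas.germ (φ.mem_Psi_of_mem l) x hx) rfl =
        OrbifoldAtlas.germ (φ.mem_Psi_of_mem k) x hkx :=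
      (OrbifoldAtlas.Arrow.mul_germ _ _ x hx hlx rfl).trans
        (OrbifoldAtlas.germ_eq_germ.2 ⟨rfl, e⟩)
    have h4 := φ.map_mul (OrbifoldAtlas.germ (φ.mem_Psi_of_mem m) (l.1 x) hlx)
      (OrbifoldAtlas.germ (φ.mem_Psi_of_mem l) x hx) rfl
    simp only [hm, e1, e2', e3] at h4
    have h5 := h4.trans (OrbifoldAtlas.Arrow.mul_germ (φ.transport l).2 (φ.transport m).2
      (φ.obj x) h1 h2' rfl)
    exact (OrbifoldAtlas.germ_eq_germ.1 h5).2.symm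
  ν_unit l x hx e := by
    rw [φ.coprodMap_restr]
    obtain ⟨h, e1⟩ := φ.transports l x hx
    have e2 : OrbifoldAtlas.germ (φ.mem_Psi_of_mem l) x hx = OrbifoldAtlas.Arrow.unit x :=
      OrbifoldAtlas.germ_eq_germ.2 ⟨rfl, e⟩
    exact (OrbifoldAtlas.germ_eq_germ.1 (e1.symm.trans ((congrArg φ.arr e2).trans
      (φ.map_unit x)))).2

end Hom

/-- The map `F₂` from homomorphisms to charted orbifold maps. -/
def F₂ {A : OrbifoldAtlas.{u} n Q} {B : OrbifoldAtlas.{u} n' Q'} (φ : Hom A B) : OrbMap A B :=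
  Quotient.mk (OrbMapRep.setoid A B) φ.toOrbMapRep

/-- `f` is a lift of the identity of `(Q, U)`: its domain atlas represents `U`, its underlying map is
`id`, and its local lifts are local diffeomorphisms. Both conditions do not depend on the representative. -/
def OrbMap.IsLiftOfId {n n' : ℕ} {A : OrbifoldAtlas.{u} n Q} {B : OrbifoldAtlas.{u} n' Q}
    (f : OrbMap A B) (U : OrbifoldStructure.{u} n Q) : Prop :=
  A.Represents U ∧ ∃ r : OrbMapRep A B, Quotient.mk (OrbMapRep.setoid A B) r = f ∧
    r.f = id ∧ ∀ i, IsLocalDiffeomorph (𝓡 n) (𝓡 n') ∞ (r.lift i)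

end Orb

end

/-! Both halves go through one characterization: a homomorphism `φ` of atlas groupoids over `Q` is a
unit weak equivalence exactly when `φ₀` is a local diffeomorphism with `π' ∘ φ₀ = π`. For the
homomorphism of a lift of the identity the second property is immediate, and the first holds because
on each component it is the corresponding local lift. In the other direction `F₂` takes restrictions
of `φ₀` as local lifts, so they inherit the local diffeomorphism property.

Suppose `φ₀` is a local diffeomorphism over `Q`. Near any point, `t ∘ pr₁` is the composite of the
étale projection to `G₀`, of `φ₀`, and of a transition; so it is a local diffeomorphism, in
particular a submersion. It is surjective because points of the target atlas with the same image in
`Q` are joined by a transition. The map `(s, t, φ₁)` is an immersion since `s` is already étale.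
Near its source an arrow satisfies `φ₀ ∘ a = φ₁(a) ∘ φ₀`, and `φ₀` is injective near the target, so
the arrow is recovered from its source, target and image; this gives injectivity
(`arrow_ext_of_isLocalDiffeomorph`) and the topological embedding. Conversely an arrow from `φ₀ x`
to `φ₀ y` is conjugated back by local inverses of `φ₀` (`exists_arr_eq`), which identifies the
range.

Suppose `φ` is a weak equivalence. If `φ₀ z = φ₀ w` with `z`, `w` close to `x`, the fibered product
provides an arrow from `z` to `w` over a unit. By the embedding property it is close to the unit at
`x`, hence is itself a unit, and `z = w` (`exists_injOn_obj`). Along the unit section of `H₁ ×_{s,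
φ₀} G₀` the map `t ∘ pr₁` is `φ₀`, so this submersion is locally injective and therefore a local
diffeomorphism (`isLocalDiffeomorphAt_of_isSubmersionAt`). If moreover the marking is respected, the
dimensions agree when `Q` is nonempty, restrictions of `φ₀` are changes of charts between the two
atlases, and maximality makes the structures equal. -/

open scoped Manifold ContDiff Topology

noncomputable section

namespace Orb

/-! ### Local diffeomorphisms, submersions and immersions in charts -/

section Manifolds

variable {E E₁ E₂ : Type*} [NormedAddCommGroup E] [NormedSpace ℝ E]
  [NormedAddCommGroup E₁] [NormedSpace ℝ E₁] [NormedAddCommGroup E₂] [NormedSpace ℝ E₂]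
  {M N N₁ N₂ : Type*} [TopologicalSpace M] [ChartedSpace E M]
  [TopologicalSpace N] [ChartedSpace E N]
  [TopologicalSpace N₁] [ChartedSpace E₁ N₁] [TopologicalSpace N₂] [ChartedSpace E₂ N₂]

/-- A map to a manifold is smooth in both directions if all its composites with charts are charts. -/
lemma contMDiffOn_of_trans_mem_maximalAtlas [IsManifold 𝓘(ℝ, E) ∞ M] [IsManifold 𝓘(ℝ, E) ∞ N]
    (e : OpenPartialHomeomorph M N)
    (he : ∀ c ∈ atlas E N, e.trans c ∈ IsManifold.maximalAtlas 𝓘(ℝ, E) ∞ M) :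
    ContMDiffOn 𝓘(ℝ, E) 𝓘(ℝ, E) ∞ e e.source ∧
      ContMDiffOn 𝓘(ℝ, E) 𝓘(ℝ, E) ∞ e.symm e.target := by
  constructor
  · intro x hx
    have hc := mem_chart_source E (e x)
    have hec := he _ (chart_mem_atlas E (e x))
    have hxs : x ∈ (e.trans (chartAt E (e x))).source := by
      rw [OpenPartialHomeomorph.trans_source]; exact ⟨hx, hc⟩
    have h1 := contMDiffAt_of_mem_maximalAtlas hec hxs
    have h2 : ContMDiffAt 𝓘(ℝ, E) 𝓘(ℝ, E) ∞ (chartAt E (e x)).symm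
        ((e.trans (chartAt E (e x))) x) :=
      contMDiffAt_symm_of_mem_maximalAtlas (IsManifold.chart_mem_maximalAtlas (e x))
        ((chartAt E (e x)).map_source hc)
    refine ((h2.comp x h1).congr_of_eventuallyEq ?_).contMDiffWithinAt
    filter_upwards [(e.trans (chartAt E (e x))).open_source.mem_nhds hxs] with z hz
    rw [OpenPartialHomeomorph.trans_source] at hz
    exact ((chartAt E (e x)).left_inv hz.2).symm
  · intro y hy
    have hc := mem_chart_source E y
    have hec := he _ (chart_mem_atlas E y)
    have h1 : ContMDiffAt 𝓘(ℝ, E) 𝓘(ℝ, E) ∞ (chartAt E y) y :=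
      contMDiffAt_of_mem_maximalAtlas (IsManifold.chart_mem_maximalAtlas y) hc
    have h2 : ContMDiffAt 𝓘(ℝ, E) 𝓘(ℝ, E) ∞ (e.trans (chartAt E y)).symm (chartAt E y y) := by
      refine contMDiffAt_symm_of_mem_maximalAtlas hec ?_
      rw [OpenPartialHomeomorph.trans_target]
      refine ⟨(chartAt E y).map_source hc, ?_⟩
      rw [Set.mem_preimage, (chartAt E y).left_inv hc]
      exact hy
    refine ((h2.comp y h1).congr_of_eventuallyEq ?_).contMDiffWithinAt
    filter_upwards [(chartAt E y).open_source.mem_nhds hc] with z hz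
    exact congrArg e.symm ((chartAt E y).left_inv hz).symm

/-- An open partial homeomorphism, smooth in both directions, is a local diffeomorphism. -/
lemma isLocalDiffeomorphAt_of_contMDiffOn {f : M → N₁} (e : OpenPartialHomeomorph M N₁)
    (h : ContMDiffOn 𝓘(ℝ, E) 𝓘(ℝ, E₁) ∞ e e.source)
    (h' : ContMDiffOn 𝓘(ℝ, E₁) 𝓘(ℝ, E) ∞ e.symm e.target) {x : M} (hx : x ∈ e.source)
    (hf : f =ᶠ[𝓝 x] e) : IsLocalDiffeomorphAt 𝓘(ℝ, E) 𝓘(ℝ, E₁) ∞ f x := by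
  obtain ⟨s, hs, hso, hxs⟩ := mem_nhds_iff.1 hf
  refine ⟨{ toPartialEquiv := (e.restrOpen s hso).toPartialEquiv
            open_source := (e.restrOpen s hso).open_source
            open_target := (e.restrOpen s hso).open_target
            contMDiffOn_toFun := h.mono fun _ hx => hx.1
            contMDiffOn_invFun := h'.mono fun _ hx => hx.1 }, ⟨hx, hxs⟩, fun z hz => hs hz.2⟩

/-- A local diffeomorphism agrees near a given point with an open partial homeomorphism that is
smooth in both directions. -/
lemma exists_openPartialHomeomorph {f : M → N₁} {x : M}
    (hf : IsLocalDiffeomorphAt 𝓘(ℝ, E) 𝓘(ℝ, E₁) ∞ f x) :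
    ∃ e : OpenPartialHomeomorph M N₁, x ∈ e.source ∧ (∀ z ∈ e.source, e z = f z) ∧
      ContMDiffOn 𝓘(ℝ, E) 𝓘(ℝ, E₁) ∞ e e.source ∧
      ContMDiffOn 𝓘(ℝ, E₁) 𝓘(ℝ, E) ∞ e.symm e.target := by
  obtain ⟨Φ, hx, h⟩ := hf
  exact ⟨Φ.toOpenPartialHomeomorph, hx, fun z hz => (h hz).symm, Φ.contMDiffOn_toFun,
    Φ.contMDiffOn_invFun⟩

lemma isLocalDiffeomorphAt_congr {f g : M → N₁} {x : M}
    (hf : IsLocalDiffeomorphAt 𝓘(ℝ, E) 𝓘(ℝ, E₁) ∞ f x) (h : g =ᶠ[𝓝 x] f) :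
    IsLocalDiffeomorphAt 𝓘(ℝ, E) 𝓘(ℝ, E₁) ∞ g x := by
  obtain ⟨e, hx, he, h1, h2⟩ := exists_openPartialHomeomorph hf
  refine isLocalDiffeomorphAt_of_contMDiffOn e h1 h2 hx (h.trans ?_)
  filter_upwards [e.open_source.mem_nhds hx] with z hz using (he z hz).symm

lemma exists_continuousLinearEquiv {f : M → N₁} {x : M}
    (hf : IsLocalDiffeomorphAt 𝓘(ℝ, E) 𝓘(ℝ, E₁) ∞ f x) : Nonempty (E ≃L[ℝ] E₁) :=
  ⟨hf.mfderivToContinuousLinearEquiv (by simp)⟩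

/-- The domain chart is `f` followed by a chart `c` of the codomain and a linear isomorphism `L⁻¹`,
so that in these charts `f` is `L` itself and the complement is trivial. The derivative supplies
`L`; any linear isomorphism of the model spaces would serve. -/
lemma isSubmersionAtOfComplement_of_isLocalDiffeomorphAt [IsManifold 𝓘(ℝ, E) ∞ M]
    [IsManifold 𝓘(ℝ, E₁) ∞ N₁] {f : M → N₁} {x : M}
    (hf : IsLocalDiffeomorphAt 𝓘(ℝ, E) 𝓘(ℝ, E₁) ∞ f x) :
    Manifold.IsSubmersionAtOfComplement PUnit.{1} 𝓘(ℝ, E) 𝓘(ℝ, E₁) ∞ f x := by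
  obtain ⟨L⟩ := exists_continuousLinearEquiv hf
  obtain ⟨e, hx, he, h1, h2⟩ := exists_openPartialHomeomorph hf
  set c := chartAt E₁ (f x)
  have hcs : f x ∈ c.source := mem_chart_source E₁ (f x)
  have hcm : c ∈ IsManifold.maximalAtlas 𝓘(ℝ, E₁) ∞ N₁ := IsManifold.chart_mem_maximalAtlas (f x)
  let d : OpenPartialHomeomorph M E :=
    e.trans (c.trans L.symm.toHomeomorph.toOpenPartialHomeomorph)
  have hds : ∀ z, z ∈ d.source ↔ z ∈ e.source ∧ e z ∈ c.source := by
    intro z; simp [d]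
  have hdt : ∀ y, y ∈ d.target ↔ L y ∈ c.target ∧ c.symm (L y) ∈ e.target := by
    intro y; simp [d]
  refine .mk_of_charts (L.trans (ContinuousLinearEquiv.prodUnique ℝ E₁ PUnit).symm) d c ?_ hcs ?_
    hcm ?_ ?_
  · exact (hds x).2 ⟨hx, by rw [he x hx]; exact hcs⟩
  · refine OpenPartialHomeomorph.mem_maximalAtlas_of_contMDiffOn d ?_ ?_
    · have h3 := (contMDiffOn_of_mem_maximalAtlas hcm).comp
        (h1.mono (t := d.source) fun z hz => ((hds z).1 hz).1) fun z hz => ((hds z).1 hz).2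
      exact L.symm.contDiff.contMDiff.comp_contMDiffOn h3
    · refine h2.comp ((contMDiffOn_symm_of_mem_maximalAtlas hcm).comp
        L.contDiff.contMDiff.contMDiffOn fun y hy => ((hdt y).1 hy).1) fun y hy => ((hdt y).1 hy).2
  · intro z hz
    rw [Set.mem_preimage, ← he z ((hds z).1 hz).1]
    exact ((hds z).1 hz).2
  · intro y hy
    have hy' : y ∈ d.target := by simpa using hy
    obtain ⟨h3, h4⟩ := (hdt y).1 hy'
    have h5 : f (e.symm (c.symm (L y))) = c.symm (L y) := by
      rw [← he _ (e.map_target h4), e.right_inv h4]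
    change c (f (e.symm (c.symm (L y)))) = L y
    rw [h5, c.right_inv h3]

/-- A locally injective submersion is a local diffeomorphism. -/
lemma isLocalDiffeomorphAt_of_isSubmersionAt {f : M → N₁} {x : M}
    (hf : Manifold.IsSubmersionAt 𝓘(ℝ, E) 𝓘(ℝ, E₁) ∞ f x) {s : Set M} (hs : s ∈ 𝓝 x)
    (hinj : Set.InjOn f s) : IsLocalDiffeomorphAt 𝓘(ℝ, E) 𝓘(ℝ, E₁) ∞ f x := by
  obtain ⟨F, _, _, h⟩ := hf
  have hx := h.mem_domChart_source
  have hdm := h.domChart_mem_maximalAtlas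
  have hcm := h.codChart_mem_maximalAtlas
  have hsub := h.source_subset_preimage_source
  have hw : ∀ z ∈ h.domChart.source, h.codChart (f z) = (h.equiv (h.domChart z)).1 := by
    intro z hz
    have hz' : h.domChart z ∈ (h.domChart.extend 𝓘(ℝ, E)).target := by
      simpa using h.domChart.map_source hz
    have := h.writtenInCharts hz'
    simpa [h.domChart.left_inv hz] using this
  generalize h.domChart = d, h.codChart = c, h.equiv = L at *
  -- In the charts `f` is the projection along the complement `F`, so it is constant on the segment
  -- through `d x` in the direction `(0, v)`. Local injectivity leaves no room for such a segment
  -- unless `v = 0`.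
  have hF : ∀ v : F, v = 0 := by
    intro v
    let γ : ℝ → E := fun t => d x + t • L.symm (0, v)
    have hγ : Continuous γ := by fun_prop
    have hγ0 : γ 0 = d x := by simp [γ]
    have h1 : ∀ᶠ t in 𝓝 (0 : ℝ), γ t ∈ d.target ∧ d.symm (γ t) ∈ s := by
      have ht : Filter.Tendsto γ (𝓝 0) (𝓝 (d x)) := hγ0 ▸ hγ.tendsto 0
      have ht' : Filter.Tendsto d.symm (𝓝 (d x)) (𝓝 x) := by
        have := d.symm.continuousAt (d.map_source hx)
        rwa [ContinuousAt, d.left_inv hx] at this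
      exact (ht.eventually (d.open_target.mem_nhds (d.map_source hx))).and
        ((ht'.comp ht).eventually hs)
    -- A nonzero `t` small enough that the point stays in the chart and in `s`.
    obtain ⟨t, ⟨htt, hts⟩, ht0⟩ := ((h1.filter_mono nhdsWithin_le_nhds).and
      (self_mem_nhdsWithin : {(0 : ℝ)}ᶜ ∈ 𝓝[≠] (0 : ℝ))).exists
    have h2 : c (f (d.symm (γ t))) = c (f x) := by
      rw [hw _ (d.map_target htt), hw _ hx, d.right_inv htt]
      simp [γ]
    have h3 : f (d.symm (γ t)) = f x := c.injOn (hsub (d.map_target htt)) (hsub hx) h2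
    have h4 := hinj hts (mem_of_mem_nhds hs) h3
    have h5 : γ t = d x := by rw [← d.right_inv htt, h4]
    have h6 : t • L.symm (0, v) = 0 := by simpa [γ] using h5
    have h7 := (smul_eq_zero.1 h6).resolve_left ht0
    have h8 : ((0, v) : E₁ × F) = 0 := by simpa using h7
    exact congrArg Prod.snd h8
  -- With a trivial complement the projection is a linear isomorphism `K`, and `f` is `c⁻¹ ∘ K ∘ d`
  -- near `x`.
  let _ : Unique F := ⟨⟨0⟩, hF⟩
  let K : E ≃L[ℝ] E₁ := L.trans (ContinuousLinearEquiv.prodUnique ℝ E₁ F)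
  have hK : ∀ y, K y = (L y).1 := fun y => rfl
  let e : OpenPartialHomeomorph M N₁ :=
    d.trans (K.toHomeomorph.toOpenPartialHomeomorph.trans c.symm)
  have hes : ∀ z, z ∈ e.source ↔ z ∈ d.source ∧ K (d z) ∈ c.target := by
    intro z; simp [e]
  have het : ∀ y, y ∈ e.target ↔ y ∈ c.source ∧ K.symm (c y) ∈ d.target := by
    intro y; simp [e]
  refine isLocalDiffeomorphAt_of_contMDiffOn e ?_ ?_ ((hes x).2 ⟨hx, ?_⟩) ?_
  · refine (contMDiffOn_symm_of_mem_maximalAtlas hcm).comp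
      (K.contDiff.contMDiff.comp_contMDiffOn ((contMDiffOn_of_mem_maximalAtlas hdm).mono
        fun z hz => ((hes z).1 hz).1)) fun z hz => ((hes z).1 hz).2
  · refine (contMDiffOn_symm_of_mem_maximalAtlas hdm).comp
      (K.symm.contDiff.contMDiff.comp_contMDiffOn ((contMDiffOn_of_mem_maximalAtlas hcm).mono
        fun z hz => ((het z).1 hz).1)) fun z hz => ((het z).1 hz).2
  · rw [hK, ← hw x hx]
    exact c.map_source (hsub hx)
  · filter_upwards [d.open_source.mem_nhds hx] with z hz
    change f z = c.symm (K (d z))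
    rw [hK, ← hw z hz, c.left_inv (hsub hz)]

/-- The shear `((x, y), z) ↦ ((x, y - g x), z - h x)` over an open set `U`. -/
def shear {U : Set E} (hU : IsOpen U) {g : E → E₁} {h : E → E₂} (hg : ContinuousOn g U)
    (hh : ContinuousOn h U) :
    OpenPartialHomeomorph (ModelProd (ModelProd E E₁) E₂) (ModelProd (ModelProd E E₁) E₂) where
  toFun p := ((p.1.1, p.1.2 - g p.1.1), p.2 - h p.1.1)
  invFun p := ((p.1.1, p.1.2 + g p.1.1), p.2 + h p.1.1)
  source := {p | p.1.1 ∈ U}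
  target := {p | p.1.1 ∈ U}
  map_source' _ hp := hp
  map_target' _ hp := hp
  left_inv' p _ := by simp
  right_inv' p _ := by simp
  open_source := hU.preimage (continuous_fst.comp continuous_fst)
  open_target := hU.preimage (continuous_fst.comp continuous_fst)
  continuousOn_toFun := by
    have h1 : ContinuousOn (fun p : (E × E₁) × E₂ => p.1.1) {p | p.1.1 ∈ U} := by fun_prop
    exact ((h1.prodMk ((continuous_snd.comp continuous_fst).continuousOn.sub
      (hg.comp h1 fun _ hp => hp))).prodMk (continuous_snd.continuousOn.sub
      (hh.comp h1 fun _ hp => hp)))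
  continuousOn_invFun := by
    have h1 : ContinuousOn (fun p : (E × E₁) × E₂ => p.1.1) {p | p.1.1 ∈ U} := by fun_prop
    exact ((h1.prodMk ((continuous_snd.comp continuous_fst).continuousOn.add
      (hg.comp h1 fun _ hp => hp))).prodMk (continuous_snd.continuousOn.add
      (hh.comp h1 fun _ hp => hp)))

lemma shear_mem_contDiffGroupoid {U : Set E} (hU : IsOpen U) {g : E → E₁} {h : E → E₂}
    (hg : ContDiffOn ℝ ∞ g U) (hh : ContDiffOn ℝ ∞ h U) :
    shear hU hg.continuousOn hh.continuousOn ∈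
      contDiffGroupoid ∞ ((𝓘(ℝ, E).prod 𝓘(ℝ, E₁)).prod 𝓘(ℝ, E₂)) := by
  have h1 : ContDiffOn ℝ ∞ (fun p : (E × E₁) × E₂ => p.1.1) {p | p.1.1 ∈ U} :=
    (contDiff_fst.comp contDiff_fst).contDiffOn
  have h2 : ContDiffOn ℝ ∞ (fun p : (E × E₁) × E₂ => p.1.2) {p | p.1.1 ∈ U} :=
    (contDiff_snd.comp contDiff_fst).contDiffOn
  have h3 : ContDiffOn ℝ ∞ (fun p : (E × E₁) × E₂ => p.2) {p | p.1.1 ∈ U} :=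
    contDiff_snd.contDiffOn
  have h4 := hg.comp h1 fun _ hp => hp
  have h5 := hh.comp h1 fun _ hp => hp
  refine ⟨?_, ?_⟩
  · exact ((h1.prodMk (h2.sub h4)).prodMk (h3.sub h5)).mono fun p hp => hp.1
  · exact ((h1.prodMk (h2.add h4)).prodMk (h3.add h5)).mono fun p hp => hp.1

/-- Needed to see that a product chart followed by a shear is still an admissible chart of the
codomain of an immersion. -/
lemma trans_mem_maximalAtlas {𝕜 V H X : Type*} [NontriviallyNormedField 𝕜]
    [NormedAddCommGroup V] [NormedSpace 𝕜 V] [TopologicalSpace H] {I : ModelWithCorners 𝕜 V H}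
    [TopologicalSpace X] [ChartedSpace H X] {m : WithTop ℕ∞}
    {c : OpenPartialHomeomorph X H} (hc : c ∈ IsManifold.maximalAtlas I m X)
    {e : OpenPartialHomeomorph H H} (he : e ∈ contDiffGroupoid m I) :
    c.trans e ∈ IsManifold.maximalAtlas I m X := by
  rw [IsManifold.mem_maximalAtlas_iff] at hc ⊢
  intro c' hc'
  obtain ⟨h1, h2⟩ := hc c' hc'
  constructor
  · rw [OpenPartialHomeomorph.trans_symm_eq_symm_trans_symm, OpenPartialHomeomorph.trans_assoc]
    exact (contDiffGroupoid m I).trans ((contDiffGroupoid m I).symm he) h1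
  · rw [← OpenPartialHomeomorph.trans_assoc]
    exact (contDiffGroupoid m I).trans h2 he

/-- A map one of whose components is a local diffeomorphism is an immersion. -/
lemma isImmersionAtOfComplement_prodMk [IsManifold 𝓘(ℝ, E) ∞ M] [IsManifold 𝓘(ℝ, E) ∞ N]
    [IsManifold 𝓘(ℝ, E₁) ∞ N₁] [IsManifold 𝓘(ℝ, E₂) ∞ N₂] {s : M → N} {t : M → N₁} {k : M → N₂}
    {a : M} (hs : IsLocalDiffeomorphAt 𝓘(ℝ, E) 𝓘(ℝ, E) ∞ s a)
    (ht : ContMDiff 𝓘(ℝ, E) 𝓘(ℝ, E₁) ∞ t) (hk : ContMDiff 𝓘(ℝ, E) 𝓘(ℝ, E₂) ∞ k) :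
    Manifold.IsImmersionAtOfComplement (E₁ × E₂) 𝓘(ℝ, E)
      ((𝓘(ℝ, E).prod 𝓘(ℝ, E₁)).prod 𝓘(ℝ, E₂)) ∞ (fun b => ((s b, t b), k b)) a := by
  obtain ⟨e, ha, he, h1, h2⟩ := exists_openPartialHomeomorph hs
  have hc : chartAt E (s a) ∈ IsManifold.maximalAtlas 𝓘(ℝ, E) ∞ N :=
    IsManifold.chart_mem_maximalAtlas (s a)
  have hc₁ : chartAt E₁ (t a) ∈ IsManifold.maximalAtlas 𝓘(ℝ, E₁) ∞ N₁ :=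
    IsManifold.chart_mem_maximalAtlas (t a)
  have hc₂ : chartAt E₂ (k a) ∈ IsManifold.maximalAtlas 𝓘(ℝ, E₂) ∞ N₂ :=
    IsManifold.chart_mem_maximalAtlas (k a)
  have hac : s a ∈ (chartAt E (s a)).source := mem_chart_source E (s a)
  have hac₁ : t a ∈ (chartAt E₁ (t a)).source := mem_chart_source E₁ (t a)
  have hac₂ : k a ∈ (chartAt E₂ (k a)).source := mem_chart_source E₂ (k a)
  generalize chartAt E (s a) = c, chartAt E₁ (t a) = c₁, chartAt E₂ (k a) = c₂ at *
  let O : Set M := t ⁻¹' c₁.source ∩ k ⁻¹' c₂.source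
  have hO : IsOpen O := (c₁.open_source.preimage ht.continuous).inter
    (c₂.open_source.preimage hk.continuous)
  have haO : a ∈ O := ⟨hac₁, hac₂⟩
  -- The chart of `M` pulled back along `s`: read from `d` to `c`, the component `s` is the
  -- identity. Restricting to `O` keeps `t` and `k` inside their charts.
  let d : OpenPartialHomeomorph M E := (e.restrOpen O hO).trans c
  have hds : ∀ z, z ∈ d.source ↔ (z ∈ e.source ∧ z ∈ O) ∧ s z ∈ c.source := by
    intro z
    simp only [d, OpenPartialHomeomorph.trans_source, OpenPartialHomeomorph.restrOpen_source,
      Set.mem_inter_iff, Set.mem_preimage]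
    exact and_congr_right fun h => by rw [← he z h.1]; rfl
  have hdv : ∀ z ∈ d.source, d z = c (s z) := fun z hz =>
    congrArg c (he z ((hds z).1 hz).1.1)
  have hdm : d ∈ IsManifold.maximalAtlas 𝓘(ℝ, E) ∞ M := by
    refine OpenPartialHomeomorph.mem_maximalAtlas_of_contMDiffOn d ?_ ?_
    · refine (contMDiffOn_of_mem_maximalAtlas hc).comp
        (h1.mono fun z hz => ((hds z).1 hz).1.1) fun z hz => ?_
      change e z ∈ c.source
      rw [he z ((hds z).1 hz).1.1]
      exact ((hds z).1 hz).2
    · refine h2.comp ((contMDiffOn_symm_of_mem_maximalAtlas hc).mono fun y hy => ?_) fun y hy => ?_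
      · exact hy.1
      · exact hy.2.1
  have hdsymm := contMDiffOn_symm_of_mem_maximalAtlas hdm
  have hg : ContDiffOn ℝ ∞ (c₁ ∘ t ∘ d.symm) d.target := by
    rw [← contMDiffOn_iff_contDiffOn]
    exact (contMDiffOn_of_mem_maximalAtlas hc₁).comp (ht.comp_contMDiffOn hdsymm)
      fun y hy => ((hds _).1 (d.map_target hy)).1.2.1
  have hh : ContDiffOn ℝ ∞ (c₂ ∘ k ∘ d.symm) d.target := by
    rw [← contMDiffOn_iff_contDiffOn]
    exact (contMDiffOn_of_mem_maximalAtlas hc₂).comp (hk.comp_contMDiffOn hdsymm)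
      fun y hy => ((hds _).1 (d.map_target hy)).1.2.2
  have had : a ∈ d.source := (hds a).2 ⟨⟨ha, haO⟩, hac⟩
  have hmem : ∀ z ∈ d.source, ((s z, t z), k z) ∈ (((c.prod c₁).prod c₂).trans
      (shear d.open_target hg.continuousOn hh.continuousOn)).source := by
    intro z hz
    obtain ⟨⟨-, h3, h4⟩, h5⟩ := (hds z).1 hz
    refine ⟨⟨⟨h5, h3⟩, h4⟩, ?_⟩
    change c (s z) ∈ d.target
    rw [← hdv z hz]
    exact d.map_source hz
  -- In product charts the map is the graph `y ↦ ((y, g y), h y)`. The shear flattens it to `y ↦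
  -- ((y, 0), 0)`, whence the complement `E₁ × E₂`.
  refine .mk_of_charts (ContinuousLinearEquiv.prodAssoc ℝ E E₁ E₂).symm d
    (((c.prod c₁).prod c₂).trans (shear d.open_target hg.continuousOn hh.continuousOn)) had
    (hmem a had) hdm
    (trans_mem_maximalAtlas (IsManifold.mem_maximalAtlas_prod
      (IsManifold.mem_maximalAtlas_prod hc hc₁) hc₂) (shear_mem_contDiffGroupoid _ hg hh)) hmem ?_
  intro y hy
  have hy' : y ∈ d.target := by simpa using hy
  have h3 : c (s (d.symm y)) = y := by
    rw [← hdv _ (d.map_target hy'), d.right_inv hy']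
  change ((c (s (d.symm y)), c₁ (t (d.symm y)) - c₁ (t (d.symm (c (s (d.symm y)))))),
    c₂ (k (d.symm y)) - c₂ (k (d.symm (c (s (d.symm y)))))) = ((y, (0 : E₁)), (0 : E₂))
  rw [h3, sub_self, sub_self]

/-- Open partial homeomorphisms that are smooth in both directions are closed under composition. -/
lemma contMDiffOn_trans
    {e : OpenPartialHomeomorph M N₁} {e' : OpenPartialHomeomorph N₁ N₂}
    (h : ContMDiffOn 𝓘(ℝ, E) 𝓘(ℝ, E₁) ∞ e e.source ∧
      ContMDiffOn 𝓘(ℝ, E₁) 𝓘(ℝ, E) ∞ e.symm e.target)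
    (h' : ContMDiffOn 𝓘(ℝ, E₁) 𝓘(ℝ, E₂) ∞ e' e'.source ∧
      ContMDiffOn 𝓘(ℝ, E₂) 𝓘(ℝ, E₁) ∞ e'.symm e'.target) :
    ContMDiffOn 𝓘(ℝ, E) 𝓘(ℝ, E₂) ∞ (e.trans e') (e.trans e').source ∧
      ContMDiffOn 𝓘(ℝ, E₂) 𝓘(ℝ, E) ∞ (e.trans e').symm (e.trans e').target := by
  constructor
  · exact h'.1.comp (h.1.mono fun z hz => (e.trans_source e' ▸ hz : z ∈ e.source ∩ _).1)
      fun z hz => (e.trans_source e' ▸ hz : z ∈ e.source ∩ _).2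
  · exact h.2.comp (h'.2.mono fun z hz => (e.trans_target e' ▸ hz : z ∈ e'.target ∩ _).1)
      fun z hz => (e.trans_target e' ▸ hz : z ∈ e'.target ∩ _).2

end Manifolds

variable {n : ℕ} {Q : Type v} [TopologicalSpace Q] {n' : ℕ} {Q' : Type w} [TopologicalSpace Q']

/-! ### The étale structure of the arrow space -/

namespace OrbifoldAtlas

variable {A : OrbifoldAtlas.{u} n Q}

lemma isLocalDiffeomorph_incl (c : A.charts) :
    IsLocalDiffeomorph (𝓡 n) (𝓡 n) ∞ (A.incl c) := fun _ =>
  isLocalDiffeomorphAt_of_contMDiffOn (A.inclHomeo c) (A.contMDiff_incl c).contMDiffOn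
    (A.contMDiffOn_inclHomeo_symm c) trivial Filter.EventuallyEq.rfl

lemma isLocalDiffeomorphAt_inclHomeo_symm (c : A.charts) (x : c.1.V) :
    IsLocalDiffeomorphAt (𝓡 n) (𝓡 n) ∞ (A.inclHomeo c).symm (A.incl c x) :=
  isLocalDiffeomorphAt_of_contMDiffOn (A.inclHomeo c).symm (A.contMDiffOn_inclHomeo_symm c)
    (A.contMDiff_incl c).contMDiffOn ⟨x, trivial, rfl⟩ Filter.EventuallyEq.rfl

lemma inclHomeo_symm_incl (c : A.charts) (x : c.1.V) :
    (A.inclHomeo c).symm (A.incl c x) = x :=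
  (A.inclHomeo c).left_inv (Set.mem_univ x)

namespace Arrow

/-- The atlas of the arrow space consists of these charts, valued in `A.Total`, followed by charts
of `A.Total`. Each is thus smooth in both directions as a map of manifolds. -/
lemma contMDiffOn_chart {f : OpenPartialHomeomorph A.Total A.Total} (hf : f ∈ A.Psi) :
    ContMDiffOn (𝓡 n) (𝓡 n) ∞ (chart hf) (chart hf).source ∧
      ContMDiffOn (𝓡 n) (𝓡 n) ∞ (chart hf).symm (chart hf).target :=
  contMDiffOn_of_trans_mem_maximalAtlas _ fun c hc =>
    IsManifold.subset_maximalAtlas ⟨chart hf, ⟨f, hf, rfl⟩, c, hc, rfl⟩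

lemma isLocalDiffeomorph_src : IsLocalDiffeomorph (𝓡 n) (𝓡 n) ∞ (src : A.Arrow → A.Total) :=
  fun a => isLocalDiffeomorphAt_of_contMDiffOn (chart a.rep_mem) (contMDiffOn_chart _).1
    (contMDiffOn_chart _).2 ⟨a.src, a.src_mem, a.germ_rep.symm⟩ Filter.EventuallyEq.rfl

lemma mem_basic_rep (a : A.Arrow) : a ∈ basic a.rep_mem := ⟨a.src, a.src_mem, a.germ_rep.symm⟩

/-- On the germs of a fixed transition `f` one has `t = f ∘ s`. -/
lemma contMDiff_tgt : ContMDiff (𝓡 n) (𝓡 n) ∞ (tgt : A.Arrow → A.Total) := by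
  intro a
  have h1 : ContMDiffAt (𝓡 n) (𝓡 n) ∞ a.rep a.src :=
    a.rep_mem.1.1.contMDiffAt (a.rep.open_source.mem_nhds a.src_mem)
  refine (h1.comp a (isLocalDiffeomorph_src a).contMDiffAt).congr_of_eventuallyEq ?_
  filter_upwards [(isOpen_basic a.rep_mem).mem_nhds a.mem_basic_rep] with b hb
  obtain ⟨x, hx, rfl⟩ := hb
  rfl

/-- If an arrow lies in the basic open set of `f`, it is the germ of `f` at its source. -/
lemma eq_germ_of_mem_basic {f : OpenPartialHomeomorph A.Total A.Total} {hf : f ∈ A.Psi}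
    {a : A.Arrow} (ha : a ∈ basic hf) : ∃ hx : a.src ∈ f.source, a = germ hf a.src hx := by
  obtain ⟨x, hx, rfl⟩ := ha
  exact ⟨hx, rfl⟩

/-- Continuity of the section `z ↦ germ_z f`. It turns neighbourhoods of an arrow into
neighbourhoods of its source. -/
lemma eventually_germ {f : OpenPartialHomeomorph A.Total A.Total} (hf : f ∈ A.Psi) {x : A.Total}
    (hx : x ∈ f.source) {S : Set A.Arrow} (hS : S ∈ 𝓝 (germ hf x hx)) :
    ∀ᶠ z in 𝓝 x, ∃ hz : z ∈ f.source, germ hf z hz ∈ S := by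
  have hc := (chart hf).symm.continuousAt (x := x) hx
  have hg : ∀ (z : A.Total) (hz : z ∈ f.source), (chart hf).symm z = germ hf z hz :=
    fun z hz => dif_pos hz
  rw [ContinuousAt, hg x hx] at hc
  filter_upwards [hc hS, f.open_source.mem_nhds hx] with z h1 h2
  exact ⟨h2, by rw [← hg z h2]; exact h1⟩

end Arrow

end OrbifoldAtlas

open OrbifoldAtlas

/-! ### From a local diffeomorphism on objects to a unit weak equivalence -/

namespace Hom

section

variable {A : OrbifoldAtlas.{u} n Q} {B : OrbifoldAtlas.{u} n' Q'} (φ : Hom A B)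

lemma EssFiber.contMDiffOn_chart {f : OpenPartialHomeomorph B.Total B.Total} (hf : f ∈ B.Psi) :
    ContMDiffOn (𝓡 n) (𝓡 n) ∞ (EssFiber.chart (φ := φ) hf) (EssFiber.chart (φ := φ) hf).source ∧
      ContMDiffOn (𝓡 n) (𝓡 n) ∞ (EssFiber.chart (φ := φ) hf).symm
        (EssFiber.chart (φ := φ) hf).target :=
  contMDiffOn_of_trans_mem_maximalAtlas _ fun c hc =>
    IsManifold.subset_maximalAtlas ⟨EssFiber.chart hf, ⟨f, hf, rfl⟩, c, hc, rfl⟩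

lemma EssFiber.isLocalDiffeomorph_base :
    IsLocalDiffeomorph (𝓡 n) (𝓡 n) ∞ (fun p : φ.EssFiber => p.1.2) := fun p =>
  isLocalDiffeomorphAt_of_contMDiffOn (EssFiber.chart p.1.1.rep_mem)
    (EssFiber.contMDiffOn_chart φ _).1 (EssFiber.contMDiffOn_chart φ _).2 p.1.1.mem_basic_rep
    Filter.EventuallyEq.rfl

/-- A homomorphism is equivariant near the source of every arrow. -/
lemma obj_comp_eventuallyEq (a : A.Arrow) :
    ∀ᶠ z in 𝓝 a.src, φ.obj (a.rep z) = (φ.arr a).rep (φ.obj z) := by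
  have hS : φ.arr ⁻¹' Arrow.basic (φ.arr a).rep_mem ∈
      𝓝 (germ a.rep_mem a.src a.src_mem) := by
    rw [a.germ_rep]
    exact ((Arrow.isOpen_basic _).preimage φ.smooth_arr.continuous).mem_nhds
      (φ.arr a).mem_basic_rep
  -- By continuity `φ₁` sends the germs of `a.rep` near the source to germs of one fixed
  -- representative of `φ₁(a)`; comparing targets gives the identity.
  filter_upwards [Arrow.eventually_germ a.rep_mem a.src_mem hS] with z ⟨hz, h⟩
  obtain ⟨hx, e⟩ := Arrow.eq_germ_of_mem_basic h
  have h1 := congrArg Arrow.tgt e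
  rw [φ.map_tgt] at h1
  refine h1.trans ?_
  change (φ.arr a).rep (φ.arr (germ a.rep_mem z hz)).src = _
  rw [φ.map_src]
  rfl

/-- After composition with `φ₀`, representatives of both arrows agree near the source with the same
transition applied to `φ₀`. As `φ₀` is injective near the common target, the representatives
themselves agree. -/
lemma arrow_ext_of_isLocalDiffeomorph (h : IsLocalDiffeomorph (𝓡 n) (𝓡 n') ∞ φ.obj)
    {a b : A.Arrow} (hs : a.src = b.src) (ht : a.tgt = b.tgt) (hab : φ.arr a = φ.arr b) :
    a = b := by
  rw [← a.germ_rep, ← b.germ_rep]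
  refine germ_eq_germ.2 ⟨hs, ?_⟩
  obtain ⟨e, he, heq, -, -⟩ := exists_openPartialHomeomorph (h a.tgt)
  have h1 := φ.obj_comp_eventuallyEq a
  have h2 := φ.obj_comp_eventuallyEq b
  rw [← hs, ← hab] at h2
  have h3 : ∀ᶠ z in 𝓝 a.src, a.rep z ∈ e.source := by
    refine (a.rep.continuousAt a.src_mem) (e.open_source.mem_nhds ?_)
    rw [a.rep_src]
    exact he
  have h4 : ∀ᶠ z in 𝓝 a.src, b.rep z ∈ e.source := by
    rw [hs]
    refine (b.rep.continuousAt b.src_mem) (e.open_source.mem_nhds ?_)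
    rw [b.rep_src, ← ht]
    exact he
  filter_upwards [h1, h2, h3, h4] with z h1 h2 h3 h4
  refine e.injOn h3 h4 ?_
  rw [heq _ h3, heq _ h4, h1, h2]

/-- An arrow `b` whose source, target and image are close to those of `a` must be the germ of
`a.rep` at the source of `b`: the two have the same source and image, and `φ₀` separates targets
near that of `a`. Such germs are close to `a`. -/
lemma isEmbedding_of_isLocalDiffeomorph (h : IsLocalDiffeomorph (𝓡 n) (𝓡 n') ∞ φ.obj) :
    Topology.IsEmbedding fun a : A.Arrow => ((a.src, a.tgt), φ.arr a) := by
  have hcont : Continuous fun a : A.Arrow => ((a.src, a.tgt), φ.arr a) :=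
    (Arrow.isLocalDiffeomorph_src.contMDiff.continuous.prodMk
      Arrow.contMDiff_tgt.continuous).prodMk φ.smooth_arr.continuous
  refine ⟨Topology.isInducing_iff_nhds.2 fun a => le_antisymm hcont.continuousAt.le_comap ?_,
    fun a b hab => ?_⟩
  · intro S hS
    obtain ⟨e, he, heq, -, -⟩ := exists_openPartialHomeomorph (h a.tgt)
    have hS' : S ∩ φ.arr ⁻¹' Arrow.basic (φ.arr a).rep_mem ∩ Arrow.tgt ⁻¹' e.source ∈
        𝓝 (germ a.rep_mem a.src a.src_mem) := by
      rw [a.germ_rep]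
      refine Filter.inter_mem (Filter.inter_mem hS ?_) ?_
      · exact ((Arrow.isOpen_basic _).preimage φ.smooth_arr.continuous).mem_nhds
          (φ.arr a).mem_basic_rep
      · exact (e.open_source.preimage Arrow.contMDiff_tgt.continuous).mem_nhds he
    have h1 := Arrow.eventually_germ a.rep_mem a.src_mem hS'
    -- The three factors constrain the source (the germ of `a.rep` there lies in the trimmed `S`),
    -- the target (where `φ₀` is injective) and the image (a germ of the representative of `φ₁(a)`).
    refine Filter.mem_comap.2 ⟨({z | ∃ hz : z ∈ a.rep.source, germ a.rep_mem z hz ∈ _} ×ˢ e.source)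
      ×ˢ Arrow.basic (φ.arr a).rep_mem, prod_mem_nhds (prod_mem_nhds h1
        (e.open_source.mem_nhds he)) ((Arrow.isOpen_basic _).mem_nhds (φ.arr a).mem_basic_rep), ?_⟩
    rintro b ⟨⟨⟨hz, ⟨hbS, hb1⟩, hb2⟩, hb3⟩, hb4⟩
    obtain ⟨hx, e1⟩ := Arrow.eq_germ_of_mem_basic hb1
    obtain ⟨hx', e2⟩ := Arrow.eq_germ_of_mem_basic hb4
    have hab : φ.arr (germ a.rep_mem b.src hz) = φ.arr b := by
      refine e1.trans (Eq.trans ?_ e2.symm)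
      refine germ_eq_germ.2 ⟨?_, Filter.EventuallyEq.rfl⟩
      rw [φ.map_src, φ.map_src]
      rfl
    have hb : germ a.rep_mem b.src hz = b := by
      refine φ.arrow_ext_of_isLocalDiffeomorph h rfl (e.injOn hb2 hb3 ?_) hab
      rw [heq _ hb2, heq _ hb3, ← φ.map_tgt, ← φ.map_tgt, hab]
    rw [← hb]
    exact hbS
  · simp only [Prod.mk.injEq] at hab
    exact φ.arrow_ext_of_isLocalDiffeomorph h hab.1.1 hab.1.2 hab.2

/-- The immersion property comes from the étale component `s` alone; the assumption on `φ₀` enters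
through the topological embedding. -/
lemma isSmoothEmbedding_of_isLocalDiffeomorph (h : IsLocalDiffeomorph (𝓡 n) (𝓡 n') ∞ φ.obj) :
    Manifold.IsSmoothEmbedding (𝓡 n) (((𝓡 n).prod (𝓡 n)).prod (𝓡 n')) ∞
      fun a : A.Arrow => ((a.src, a.tgt), φ.arr a) :=
  ⟨Manifold.IsImmersionOfComplement.isImmersion fun a =>
    isImmersionAtOfComplement_prodMk (Arrow.isLocalDiffeomorph_src a) Arrow.contMDiff_tgt
      φ.smooth_arr, φ.isEmbedding_of_isLocalDiffeomorph h⟩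

/-- Near `p` this map is the base projection, then `φ₀`, then a representative of the arrow of `p`,
all local diffeomorphisms. -/
lemma EssFiber.isLocalDiffeomorph_tgt (h : IsLocalDiffeomorph (𝓡 n) (𝓡 n') ∞ φ.obj) :
    IsLocalDiffeomorph (𝓡 n) (𝓡 n') ∞ (EssFiber.tgt : φ.EssFiber → B.Total) := by
  intro p
  have h1 : IsLocalDiffeomorphAt (𝓡 n') (𝓡 n') ∞ p.1.1.rep (φ.obj p.1.2) :=
    isLocalDiffeomorphAt_of_contMDiffOn p.1.1.rep p.1.1.rep_mem.1.1 p.1.1.rep_mem.1.2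
      (p.2 ▸ p.1.1.src_mem) Filter.EventuallyEq.rfl
  refine isLocalDiffeomorphAt_congr
    (((EssFiber.isLocalDiffeomorph_base φ p).comp _ _ (h p.1.2)).comp _ _ h1) ?_
  filter_upwards [((Arrow.isOpen_basic p.1.1.rep_mem).preimage
    EssFiber.continuous_arrow).mem_nhds p.1.1.mem_basic_rep] with q hq
  obtain ⟨hx, e⟩ := Arrow.eq_germ_of_mem_basic hq
  refine (congrArg Arrow.tgt e).trans ?_
  change p.1.1.rep q.1.1.src = p.1.1.rep (φ.obj q.1.2)
  rw [q.2]

end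

variable {A : OrbifoldAtlas.{u} n Q} {B : OrbifoldAtlas.{u} n' Q} (φ : Hom A B)

/-- Conjugating a representative of `b` by the local diffeomorphism `φ₀` at `x` and at `y` gives a
transition `l` of `A`; it preserves the projection because `φ₀` does. -/
lemma exists_arr_eq (h : IsLocalDiffeomorph (𝓡 n) (𝓡 n') ∞ φ.obj)
    (hp : ∀ x, B.proj (φ.obj x) = A.proj x) {x y : A.Total} {b : B.Arrow}
    (hx : φ.obj x = b.src) (hy : φ.obj y = b.tgt) :
    ∃ a : A.Arrow, a.src = x ∧ a.tgt = y ∧ φ.arr a = b := by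
  obtain ⟨e, hex, he, hes⟩ := exists_openPartialHomeomorph (h x)
  obtain ⟨e', hey, he', hes'⟩ := exists_openPartialHomeomorph (h y)
  have hes'' : ContMDiffOn (𝓡 n') (𝓡 n) ∞ e'.symm e'.symm.source ∧
      ContMDiffOn (𝓡 n) (𝓡 n') ∞ e'.symm.symm e'.symm.target := ⟨hes'.2, hes'.1⟩
  let l : OpenPartialHomeomorph A.Total A.Total := (e.trans b.rep).trans e'.symm
  have hls : ∀ z, z ∈ l.source ↔ (z ∈ e.source ∧ e z ∈ b.rep.source) ∧ b.rep (e z) ∈ e'.target := by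
    intro z; simp [l]
  have hlv : ∀ z ∈ l.source, φ.obj (l z) = b.rep (φ.obj z) := by
    intro z hz
    obtain ⟨⟨h1, h2⟩, h3⟩ := (hls z).1 hz
    change φ.obj (e'.symm (b.rep (e z))) = _
    rw [← he' _ (e'.map_target h3), e'.right_inv h3, he z h1]
  have hl : l ∈ A.Psi := by
    refine ⟨contMDiffOn_trans (contMDiffOn_trans hes b.rep_mem.1) hes'', fun z hz => ?_⟩
    obtain ⟨⟨h1, h2⟩, h3⟩ := (hls z).1 hz
    rw [he z h1] at h2
    rw [← hp, hlv z hz, b.rep_mem.2 _ h2, hp]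
  have hbx : b.rep (e x) = e' y := by
    rw [he x hex, hx, b.rep_src, ← hy, he' y hey]
  have hxl : x ∈ l.source := by
    refine (hls x).2 ⟨⟨hex, ?_⟩, ?_⟩
    · rw [he x hex, hx]
      exact b.src_mem
    · rw [hbx]
      exact e'.map_source hey
  refine ⟨germ hl x hxl, rfl, ?_, ?_⟩
  · change e'.symm (b.rep (e x)) = y
    rw [hbx, e'.left_inv hey]
  · have hsrc : (φ.arr (germ hl x hxl)).src = φ.obj x := φ.map_src _
    rw [← (φ.arr (germ hl x hxl)).germ_rep, ← b.germ_rep]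
    refine germ_eq_germ.2 ⟨by rw [hsrc, hx], ?_⟩
    rw [hsrc]
    -- The two germs are only compared after composition with `φ₀`. Since `φ₀` is open, images of
    -- neighbourhoods of `x` are neighbourhoods of `φ₀ x`, which suffices.
    refine Filter.Eventually.filter_mono (h.isOpenMap.nhds_le x) (Filter.eventually_map.2 ?_)
    filter_upwards [φ.obj_comp_eventuallyEq (germ hl x hxl), Arrow.rep_germ hl x hxl,
      l.open_source.mem_nhds hxl] with z h1 h2 h3
    rw [← h1, h2, hlv z h3]

/-- A homomorphism over the identity of `Q` which is a local diffeomorphism on objects is a unit weak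
equivalence. -/
theorem isUnitWeakEquivalence_of_isLocalDiffeomorph
    (h : IsLocalDiffeomorph (𝓡 n) (𝓡 n') ∞ φ.obj)
    (hp : ∀ x, B.proj (φ.obj x) = A.proj x) : φ.IsUnitWeakEquivalence where
  isWeakEquivalence :=
    { surjective := by
        intro y
        obtain ⟨x, hx⟩ := A.surjective_proj (B.proj y)
        -- Both `φ₀ x` and `y` lie over the same point of `Q`, so compatibility of the charts of `B`
        -- yields a transition between them.
        obtain ⟨f, hf, hfx, hfy⟩ := B.exists_mem_Psi ((hp x).trans hx)
        exact ⟨⟨(germ hf _ hfx, x), rfl⟩, hfy⟩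
      submersion := Manifold.IsSubmersionOfComplement.isSubmersion fun p =>
        isSubmersionAtOfComplement_of_isLocalDiffeomorphAt (EssFiber.isLocalDiffeomorph_tgt φ h p)
      embedding := φ.isSmoothEmbedding_of_isLocalDiffeomorph h
      range_eq := by
        ext ⟨⟨x, y⟩, b⟩
        simp only [Set.mem_range, Set.mem_ofPred_eq, Prod.mk.injEq]
        constructor
        · rintro ⟨a, ⟨rfl, rfl⟩, rfl⟩
          exact ⟨(φ.map_src a).symm, (φ.map_tgt a).symm⟩
        · rintro ⟨hx, hy⟩
          obtain ⟨a, h1, h2, h3⟩ := φ.exists_arr_eq h hp hx hy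
          exact ⟨a, ⟨h1, h2⟩, h3⟩ }
  marking_comp := by
    funext q
    obtain ⟨x, rfl⟩ := A.surjective_proj q
    exact (φ.baseMap_proj x).trans (hp x)

end Hom

/-! ### Lifts of the identity -/

lemma OrbMapRep.isLocalDiffeomorph_ψ {A : OrbifoldAtlas.{u} n Q} {B : OrbifoldAtlas.{u} n' Q'}
    (r : OrbMapRep A B) (h : ∀ i, IsLocalDiffeomorph (𝓡 n) (𝓡 n') ∞ (r.lift i)) :
    IsLocalDiffeomorph (𝓡 n) (𝓡 n') ∞ r.ψ := by
  rintro ⟨c, x⟩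
  have h0 := A.isLocalDiffeomorphAt_inclHomeo_symm c x
  have h1 := h c ((A.inclHomeo c).symm (A.incl c x))
  have h2 := B.isLocalDiffeomorph_incl (r.range c)
    (r.lift c ((A.inclHomeo c).symm (A.incl c x)))
  refine isLocalDiffeomorphAt_congr (x := A.incl c x) ((h0.comp _ _ h1).comp _ _ h2) ?_
  filter_upwards [(A.isOpenEmbedding_incl c).isOpen_range.mem_nhds ⟨x, rfl⟩]
  rintro _ ⟨y, rfl⟩
  simp only [Function.comp_apply, inclHomeo_symm_incl]
  rfl

/-- The homomorphism of a lift of the identity is a unit weak equivalence. -/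
theorem isUnitWeakEquivalence_F₁ {A : OrbifoldAtlas.{u} n Q} {B : OrbifoldAtlas.{u} n' Q}
    {U : OrbifoldStructure.{u} n Q} {f : OrbMap A B} (hf : f.IsLiftOfId U) :
    (F₁ f).IsUnitWeakEquivalence := by
  obtain ⟨-, r, rfl, hr, hl⟩ := hf
  refine Hom.isUnitWeakEquivalence_of_isLocalDiffeomorph r.toHom (r.isLocalDiffeomorph_ψ hl) ?_
  rintro ⟨c, x⟩
  exact ((r.isLocalLift c).2 x).trans (congrFun hr _)

/-! ### From a weak equivalence to a local diffeomorphism on objects -/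

namespace Hom

variable {A : OrbifoldAtlas.{u} n Q} {B : OrbifoldAtlas.{u} n' Q'} {φ : Hom A B}

/-- If `φ₀ z = φ₀ w`, the triple `(z, w, 1)`, with `1` the unit at `φ₀ z`, lies in the fibered
product and comes from an arrow `z → w`. For `z`, `w` near `x` this triple is near the image of the
unit at `x`, so by the embedding property the arrow is a germ of the identity. -/
lemma IsWeakEquivalence.exists_injOn_obj (h : φ.IsWeakEquivalence) (x : A.Total) :
    ∃ s ∈ 𝓝 x, Set.InjOn φ.obj s := by
  have hN : Arrow.basic (A := A) refl_mem_Psi ∈ 𝓝 (Arrow.unit x) :=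
    (Arrow.isOpen_basic _).mem_nhds ⟨x, trivial, rfl⟩
  rw [h.embedding.isEmbedding.isInducing.nhds_eq_comap, Filter.mem_comap] at hN
  -- Every arrow whose image under `(s, t, φ₁)` falls in `T` is a unit.
  obtain ⟨T, hT, hTN⟩ := hN
  have hu : Filter.Tendsto (fun z => (Arrow.unit (φ.obj z) : B.Arrow)) (𝓝 x)
      (𝓝 (φ.arr (Arrow.unit x))) := by
    rw [φ.map_unit]
    intro S hS
    have h1 := Arrow.eventually_germ (refl_mem_Psi (A := B)) (x := φ.obj x) trivial hS
    exact (φ.smooth_obj.continuous.continuousAt.eventually h1).mono fun z hz => hz.2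
  have ht : Filter.Tendsto (fun p : A.Total × A.Total => (p, (Arrow.unit (φ.obj p.1) : B.Arrow)))
      (𝓝 (x, x)) (𝓝 ((x, x), φ.arr (Arrow.unit x))) :=
    Filter.Tendsto.prodMk_nhds Filter.tendsto_id (hu.comp (continuous_fst.tendsto (x, x)))
  have h2 := ht hT
  rw [nhds_prod_eq] at h2
  obtain ⟨s, hs, hsT⟩ := Filter.mem_prod_same_iff.1 h2
  refine ⟨s, hs, fun z hz w hw e => ?_⟩
  have hr : ((z, w), (Arrow.unit (φ.obj z) : B.Arrow)) ∈
      Set.range (fun a : A.Arrow => ((a.src, a.tgt), φ.arr a)) := by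
    rw [h.range_eq]
    exact Prod.ext rfl e.symm
  obtain ⟨a, ha⟩ := hr
  have haT : a ∈ Arrow.basic (A := A) refl_mem_Psi := by
    have h3 : ((z, w), (Arrow.unit (φ.obj z) : B.Arrow)) ∈ T :=
      hsT (show (z, w) ∈ s ×ˢ s from ⟨hz, hw⟩)
    have h4 : ((a.src, a.tgt), φ.arr a) ∈ T := Set.mem_of_eq_of_mem ha h3
    exact hTN h4
  simp only [Prod.mk.injEq] at ha
  obtain ⟨y, hy, rfl⟩ := haT
  exact ha.1.1.symm.trans ha.1.2

/-- A weak equivalence of atlas groupoids is a local diffeomorphism on objects. -/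
theorem IsWeakEquivalence.isLocalDiffeomorph_obj (h : φ.IsWeakEquivalence) :
    IsLocalDiffeomorph (𝓡 n) (𝓡 n') ∞ φ.obj := by
  intro x
  obtain ⟨s, hs, hinj⟩ := h.exists_injOn_obj x
  -- The value at `x` of the unit section of the fibered product. Near `p` all arrows are units, so
  -- there `t ∘ pr₁` is `φ₀` of the base point and inherits its local injectivity.
  let p : φ.EssFiber := ⟨(Arrow.unit (φ.obj x), x), rfl⟩
  have hchart : ∀ y, (EssFiber.chart (φ := φ) refl_mem_Psi).symm y =
      ⟨(Arrow.unit (φ.obj y), y), rfl⟩ := fun y =>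
    Subtype.ext (Prod.ext (dif_pos trivial) rfl)
  have hu : ∀ q : φ.EssFiber, q.1.1 ∈ Arrow.basic (A := B) refl_mem_Psi →
      q.1.1 = Arrow.unit (φ.obj q.1.2) := by
    intro q hq
    obtain ⟨hx, e⟩ := Arrow.eq_germ_of_mem_basic hq
    exact e.trans (congrArg Arrow.unit q.2)
  have hN : {q : φ.EssFiber | q.1.1 ∈ Arrow.basic (A := B) refl_mem_Psi ∧ q.1.2 ∈ s} ∈ 𝓝 p :=
    Filter.inter_mem (((Arrow.isOpen_basic _).preimage EssFiber.continuous_arrow).mem_nhds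
      ⟨φ.obj x, trivial, rfl⟩) (EssFiber.continuous_base.continuousAt hs)
  have h1 : IsLocalDiffeomorphAt (𝓡 n) (𝓡 n') ∞ (EssFiber.tgt : φ.EssFiber → B.Total) p := by
    refine isLocalDiffeomorphAt_of_isSubmersionAt (h.submersion.isSubmersionAt p) hN ?_
    rintro q ⟨hq, hqs⟩ q' ⟨hq', hqs'⟩ e
    have e1 : q.1.1.tgt = q'.1.1.tgt := e
    have hb : q.1.2 = q'.1.2 := by
      refine hinj hqs hqs' ?_
      rw [hu q hq, hu q' hq'] at e1
      exact e1
    exact Subtype.ext (Prod.ext (by rw [hu q hq, hu q' hq', hb]) hb)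
  have h2 : IsLocalDiffeomorphAt (𝓡 n) (𝓡 n) ∞
      (EssFiber.chart (φ := φ) refl_mem_Psi).symm x :=
    isLocalDiffeomorphAt_of_contMDiffOn (EssFiber.chart (φ := φ) refl_mem_Psi).symm
      (EssFiber.contMDiffOn_chart φ _).2 (EssFiber.contMDiffOn_chart φ _).1
      (Set.mem_univ (φ.obj x)) Filter.EventuallyEq.rfl
  rw [show p = _ from (hchart x).symm] at h1
  -- The inverse of the chart of the identity is the unit section, and `t ∘ pr₁` after it is `φ₀`.
  refine isLocalDiffeomorphAt_congr (h2.comp _ _ h1) (Filter.Eventually.of_forall fun y => ?_)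
  rw [Function.comp_apply, hchart y]
  rfl

lemma isLocalDiffeomorph_restr (h : IsLocalDiffeomorph (𝓡 n) (𝓡 n') ∞ φ.obj) (i : A.charts) :
    IsLocalDiffeomorph (𝓡 n) (𝓡 n') ∞ (φ.restr i) := by
  intro x
  have h1 := (A.isLocalDiffeomorph_incl i x).comp _ _ (h (A.incl i x))
  have h2 := B.isLocalDiffeomorphAt_inclHomeo_symm (φ.component i) (φ.restr i x)
  rw [← φ.obj_incl] at h2
  refine isLocalDiffeomorphAt_congr (h1.comp _ _ h2) (Filter.Eventually.of_forall fun y => ?_)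
  simp only [Function.comp_apply, φ.obj_incl, inclHomeo_symm_incl]

end Hom

/-! ### Compatibility of charts and equality of orbifold structures -/

/-- There is a diffeomorphism from a neighbourhood of `x` onto one of `y` which sends `x` to `y` and
commutes with the projections. -/
def HasChange (c d : OrbifoldChart.{u} n Q) (x : c.V) (y : d.V) : Prop :=
  ∃ h : OpenPartialHomeomorph c.V d.V, IsTransition (n := n) h ∧ x ∈ h.source ∧ h x = y ∧
    ∀ z ∈ h.source, d.π (h z) = c.π z

lemma Compatible.hasChange {c d : OrbifoldChart.{u} n Q} (h : Compatible c d) {x : c.V} {y : d.V}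
    (e : c.π x = d.π y) : HasChange c d x y := by
  obtain ⟨h, h1, -, h2⟩ := h x y e
  exact ⟨h, h1, h2⟩

lemma HasChange.symm {c d : OrbifoldChart.{u} n Q} {x : c.V} {y : d.V} (h : HasChange c d x y) :
    HasChange d c y x := by
  obtain ⟨h, h1, hx, rfl, hp⟩ := h
  refine ⟨h.symm, ⟨h1.2, h1.1⟩, h.map_source hx, h.left_inv hx, fun z hz => ?_⟩
  rw [← hp _ (h.map_target hz), h.right_inv hz]

lemma HasChange.trans {c d e : OrbifoldChart.{u} n Q} {x : c.V} {y : d.V} {z : e.V}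
    (h : HasChange c d x y) (h' : HasChange d e y z) : HasChange c e x z := by
  obtain ⟨h, h1, hx, rfl, hp⟩ := h
  obtain ⟨h', h1', hx', rfl, hp'⟩ := h'
  refine ⟨h.trans h', contMDiffOn_trans h1 h1', ?_, rfl, fun z hz => ?_⟩
  · rw [OpenPartialHomeomorph.trans_source]
    exact ⟨hx, hx'⟩
  · rw [OpenPartialHomeomorph.trans_source] at hz
    exact (hp' _ hz.2).trans (hp _ hz.1)

/-- Leaving out connectedness makes changes of charts compose freely; shrinking to the connected
component of `x` in the domain restores it. -/
lemma compatible_of_hasChange {c d : OrbifoldChart.{u} n Q}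
    (h : ∀ (x : c.V) (y : d.V), c.π x = d.π y → HasChange c d x y) : Compatible c d := by
  have hloc : LocallyConnectedSpace c.V :=
    ChartedSpace.locallyConnectedSpace (EuclideanSpace ℝ (Fin n)) c.V
  intro x y e
  obtain ⟨k, hk, hx, hxy, hp⟩ := h x y e
  have ho : IsOpen (connectedComponentIn k.source x) := k.open_source.connectedComponentIn
  have hs : (k.restrOpen _ ho).source = connectedComponentIn k.source x := by
    rw [OpenPartialHomeomorph.restrOpen_source]
    exact Set.inter_eq_right.2 (connectedComponentIn_subset _ _)
  refine ⟨k.restrOpen _ ho, IsTransition.restr' hk ho, ?_, ⟨hx, mem_connectedComponentIn hx⟩, hxy,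
    fun z hz => hp z hz.1⟩
  rw [hs]
  exact isConnected_connectedComponentIn_iff.2 hx

/-- Two orbifold structures coincide if they have representatives with compatible charts. -/
theorem OrbifoldStructure.charts_eq_of_compatible {U U' : OrbifoldStructure.{u} n Q}
    {A B : OrbifoldAtlas.{u} n Q} (hA : A.Represents U) (hB : B.Represents U')
    (h : ∀ c ∈ A.charts, ∀ d ∈ B.charts, Compatible c d) : U.charts = U'.charts := by
  have hUU' : ∀ c ∈ U.charts, ∀ d ∈ U'.charts, ∀ x y, c.π x = d.π y → HasChange c d x y := by
    intro c hc d hd x y e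
    -- Charts of `U` and `U'` are compared through points of `A` and `B` over the same point of `Q`:
    -- three changes of charts are composed.
    obtain ⟨⟨a, z⟩, hz⟩ := A.surjective_proj (c.π x)
    obtain ⟨⟨b, w⟩, hw⟩ := B.surjective_proj (c.π x)
    have hz' : a.1.π z = c.π x := hz
    have hw' : b.1.π w = c.π x := hw
    exact (((U.compatible c hc a.1 (hA a.2)).hasChange hz'.symm).trans
      ((h a.1 a.2 b.1 b.2).hasChange (hz'.trans hw'.symm))).trans
      ((U'.compatible b.1 (hB b.2) d hd).hasChange (hw'.trans e))
  -- The union of both maximal atlases is again an atlas, so maximality of each one forces it to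
  -- contain the other.
  let C : OrbifoldAtlas.{u} n Q :=
    { charts := U.charts ∪ U'.charts
      compatible := by
        rintro c (hc | hc) d (hd | hd)
        · exact U.compatible c hc d hd
        · exact compatible_of_hasChange (hUU' c hc d hd)
        · exact compatible_of_hasChange fun x y e => (hUU' d hd c hc y x e.symm).symm
        · exact U'.compatible c hc d hd
      covers := by
        refine Set.eq_univ_of_subset ?_ U.covers
        exact Set.biUnion_subset_biUnion_left Set.subset_union_left }
  exact Set.Subset.antisymm
    (Set.subset_union_left.trans (U'.maximal C Set.subset_union_right))
    (Set.subset_union_right.trans (U.maximal C Set.subset_union_left))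

/-- Chart domains are connected, hence nonempty, and cannot map to an empty space. This settles the
case where no point is available to compare dimensions. -/
lemma OrbifoldStructure.chartSet_eq_empty [IsEmpty Q] (U : OrbifoldStructure.{u} n Q) :
    U.chartSet = ∅ := by
  refine Set.eq_empty_of_forall_notMem ?_
  rintro _ ⟨c, -, rfl⟩
  have hne : Nonempty c.V := inferInstance
  exact isEmptyElim (c.π hne.some)

/-! ### Consequences of a unit weak equivalence -/

namespace Hom

lemma IsUnitWeakEquivalence.proj_obj {A : OrbifoldAtlas.{u} n Q} {B : OrbifoldAtlas.{u} n' Q}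
    {φ : Hom A B} (h : φ.IsUnitWeakEquivalence) (x : A.Total) :
    B.proj (φ.obj x) = A.proj x :=
  (φ.baseMap_proj x).symm.trans (congrFun h.marking_comp _)

/-- The charts of atlases that are connected by a unit weak equivalence are compatible. -/
lemma IsUnitWeakEquivalence.compatible {A B : OrbifoldAtlas.{u} n Q} {φ : Hom A B}
    (h : φ.IsUnitWeakEquivalence) : ∀ c ∈ A.charts, ∀ d ∈ B.charts, Compatible c d := by
  intro c hc d hd
  refine compatible_of_hasChange fun x y e => ?_
  let i : A.charts := ⟨c, hc⟩
  have hp : ∀ z : c.V, (φ.component i).1.π (φ.restr i z) = c.π z := by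
    intro z
    have h1 := h.proj_obj (A.incl i z)
    rw [φ.obj_incl] at h1
    exact h1
  -- Since `φ₀` is a local diffeomorphism over `Q`, its restriction near `x` is a change of charts
  -- from `c` to a chart of `B`; a second one inside `B` leads on to `y`.
  obtain ⟨k, hx, hk, hk1⟩ := exists_openPartialHomeomorph
    (isLocalDiffeomorph_restr h.isWeakEquivalence.isLocalDiffeomorph_obj i x)
  have h1 : HasChange c (φ.component i).1 x (φ.restr i x) :=
    ⟨k, hk1, hx, hk x hx, fun z hz => by rw [hk z hz, hp]⟩
  exact h1.trans ((B.compatible _ (φ.component i).2 d hd).hasChange ((hp x).trans e))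

/-- Over a point of `Q` the derivative of `φ₀` is a linear isomorphism, so `n = n'`; then
compatibility of the two atlases decides. -/
theorem IsUnitWeakEquivalence.chartSet_eq {A : OrbifoldAtlas.{u} n Q}
    {B : OrbifoldAtlas.{u} n' Q} {φ : Hom A B} (h : φ.IsUnitWeakEquivalence)
    {U : OrbifoldStructure.{u} n Q} {U' : OrbifoldStructure.{u} n' Q}
    (hA : A.Represents U) (hB : B.Represents U') : U.chartSet = U'.chartSet := by
  rcases isEmpty_or_nonempty Q with hQ | ⟨⟨q⟩⟩
  · rw [U.chartSet_eq_empty, U'.chartSet_eq_empty]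
  · obtain ⟨x, -⟩ := A.surjective_proj q
    obtain ⟨L⟩ := exists_continuousLinearEquiv (h.isWeakEquivalence.isLocalDiffeomorph_obj x)
    obtain rfl : n = n' := by simpa using L.toLinearEquiv.finrank_eq
    rw [OrbifoldStructure.chartSet, OrbifoldStructure.chartSet,
      OrbifoldStructure.charts_eq_of_compatible hA hB h.compatible]

/-- The charted orbifold map of a unit weak equivalence is a lift of the identity. -/
theorem IsUnitWeakEquivalence.isLiftOfId_F₂ {A : OrbifoldAtlas.{u} n Q}
    {B : OrbifoldAtlas.{u} n' Q} {φ : Hom A B} (h : φ.IsUnitWeakEquivalence)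
    {U : OrbifoldStructure.{u} n Q} (hA : A.Represents U) : (F₂ φ).IsLiftOfId U :=
  -- The underlying map of `φ.toOrbMapRep` is by definition the composite of `|φ|` with the
  -- markings, so the marking condition says that it is the identity.
  ⟨hA, φ.toOrbMapRep, rfl, h.marking_comp, fun i =>
    isLocalDiffeomorph_restr h.isWeakEquivalence.isLocalDiffeomorph_obj i⟩

end Hom

end Orb

end

/-! ### The proposition -/

theorem mainTheorem3 {Q : Type v} [TopologicalSpace Q] {n n' : ℕ}
    (U : Orb.OrbifoldStructure.{u, v} n Q) (U' : Orb.OrbifoldStructure.{u, v} n' Q)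
    (V : Orb.OrbifoldAtlas.{u, v} n Q) (W' : Orb.OrbifoldAtlas.{u, v} n' Q)
    (hV : V.Represents U) (hW' : W'.Represents U') :
    (U.chartSet = U'.chartSet →
      ∀ f : Orb.OrbMap V W', f.IsLiftOfId U → (Orb.F₁ f).IsUnitWeakEquivalence) ∧
    (∀ ε : Orb.Hom V W', ε.IsUnitWeakEquivalence →
      U.chartSet = U'.chartSet ∧ (Orb.F₂ ε).IsLiftOfId U) := by
  exact ⟨fun _ _ hf => Orb.isUnitWeakEquivalence_F₁ hf,
    fun _ hε => ⟨hε.chartSet_eq hV hW', hε.isLiftOfId_F₂ hV⟩⟩
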